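/- Let $(P,\Pi)$ be a Poisson manifold, i.e. a finite-dimensional smooth manifold $P$ (Hausdorff and second countable) with a smooth bivector field $\Pi$ whose Schouten bracket satisfies $[\Pi,\Pi]=0$, and let $\sharp\colon T^*P\to TP$ be the contraction with $\Pi$. For an (embedded) submanifold $S\subset P$ let $N^*S\subset T^*P|_S$ denote the annihilator of $TS$. A submanifold $S$ is called cosymplectic if $T_pS\oplus\sharp N_p^*S=T_pP$ for all $p\in S$; such an $S$ carries an induced bivector with sharp map $\sharp_S\colon T_p^*S\to T_pS$, $\sharp_S\tilde\xi=\sharp\xi$, where $\xi\in T_p^*P$ is the extension of $\tilde\xi$ that annihilates $\sharp N_p^*S$. A submanifold $C\subset P$ contained in $S$ is coisotropic in $S$ if $\sharp_S$ maps the annihilator of $T_pC$ in $T_p^*S$ into $T_pC$, for all $p\in C$. Let $C$ be a pre-Poisson submanifold of $(P,\Pi)$, i.e. an embedded submanifold such that the rank of $TC+\sharp N^*C$ is constant along $C$. Then there exists a cosymplectic submanifold $\tilde P$ of $P$ that contains $C$ and in which $C$ is coisotropic. -/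

import Mathlib

open scoped Manifold ContDiff

noncomputable section

/-! ### Poisson vector spaces -/

namespace PoissonLinear

variable {V : Type*} [AddCommGroup V] [Module ℝ V]

/-- The contraction `♯ : V* → V` with a bivector `B` on a finite-dimensional space `V`, the
bivector being regarded as a bilinear form on `V*`: `♯ξ` is the vector with
`η (♯ξ) = B ξ η` for all `η`. -/
def sharp [FiniteDimensional ℝ V] (B : Module.Dual ℝ V →ₗ[ℝ] Module.Dual ℝ V →ₗ[ℝ] ℝ) :
    Module.Dual ℝ V →ₗ[ℝ] V :=
  (Module.evalEquiv ℝ V).symm.toLinearMap ∘ₗ B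

theorem apply_sharp [FiniteDimensional ℝ V]
    (B : Module.Dual ℝ V →ₗ[ℝ] Module.Dual ℝ V →ₗ[ℝ] ℝ) (ξ η : Module.Dual ℝ V) :
    η (sharp B ξ) = B ξ η := by
  simp [sharp]

/-- The sharp map of a bivector: `ξ (♯ξ) = 0`. -/
def IsSkew (s : Module.Dual ℝ V →ₗ[ℝ] V) : Prop :=
  ∀ ξ : Module.Dual ℝ V, ξ (s ξ) = 0

theorem IsSkew.apply_eq_neg {s : Module.Dual ℝ V →ₗ[ℝ] V} (hs : IsSkew s)
    (ξ η : Module.Dual ℝ V) : η (s ξ) = -ξ (s η) := by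
  have h := hs (ξ + η)
  simp only [map_add, LinearMap.add_apply, hs ξ, hs η] at h
  linarith

/-- The subspace `♯ W°`. -/
def sharpAnn (s : Module.Dual ℝ V →ₗ[ℝ] V) (W : Submodule ℝ V) : Submodule ℝ V :=
  W.dualAnnihilator.map s

/-- `W` is coisotropic if `♯ W° ⊆ W`. -/
def IsCoisotropic (s : Module.Dual ℝ V →ₗ[ℝ] V) (W : Submodule ℝ V) : Prop :=
  sharpAnn s W ≤ W

/-- `W` is cosymplectic if `V = W ⊕ ♯ W°`. -/
def IsCosymplectic (s : Module.Dual ℝ V →ₗ[ℝ] V) (W : Submodule ℝ V) : Prop :=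
  IsCompl W (sharpAnn s W)

/-- The extension of `ξ ∈ W*` to `V` that annihilates `♯ W°`. -/
def extendCovector {s : Module.Dual ℝ V →ₗ[ℝ] V} {W : Submodule ℝ V}
    (hW : IsCosymplectic s W) : Module.Dual ℝ W →ₗ[ℝ] Module.Dual ℝ V :=
  (W.projectionOnto (sharpAnn s W) hW).dualMap

theorem sharp_extendCovector_mem {s : Module.Dual ℝ V →ₗ[ℝ] V} (hs : IsSkew s)
    {W : Submodule ℝ V} (hW : IsCosymplectic s W) (ξ : Module.Dual ℝ W) :
    s (extendCovector hW ξ) ∈ W := by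
  rw [← Subspace.forall_mem_dualAnnihilator_apply_eq_zero_iff]
  intro η hη
  rw [hs.apply_eq_neg]
  have h : s η ∈ sharpAnn s W := ⟨η, hη, rfl⟩
  simp [extendCovector, (Submodule.projectionOnto_apply_eq_zero_iff hW).2 h]

/-- The sharp map `♯_W : W* → W` of the bivector induced on a cosymplectic subspace `W`:
`♯_W ξ = ♯ ξ'`, where `ξ'` is the extension of `ξ` that annihilates `♯ W°`. -/
def inducedSharp {s : Module.Dual ℝ V →ₗ[ℝ] V} (hs : IsSkew s)
    {W : Submodule ℝ V} (hW : IsCosymplectic s W) : Module.Dual ℝ W →ₗ[ℝ] W :=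
  (s ∘ₗ extendCovector hW).codRestrict W (sharp_extendCovector_mem hs hW)

end PoissonLinear

/-! ### Embedded submanifolds -/

section Submanifold

variable {E : Type*} [NormedAddCommGroup E] [NormedSpace ℝ E]
  {P : Type*} [TopologicalSpace P] [ChartedSpace E P]

/-- `φ` is a smooth chart of `P` around `p` in which `S` is the linear subspace `F`. -/
structure IsSliceChart (S : Set P) (p : P) (φ : OpenPartialHomeomorph P E)
    (F : Submodule ℝ E) : Prop where
  mem_maximalAtlas : φ ∈ IsManifold.maximalAtlas 𝓘(ℝ, E) ∞ P
  mem_source : p ∈ φ.source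
  mem_iff : ∀ q ∈ φ.source, q ∈ S ↔ φ q ∈ F

variable (E) in
/-- `S` is an embedded submanifold of dimension `k`, not necessarily closed. -/
def IsEmbeddedSubmanifold (S : Set P) (k : ℕ) : Prop :=
  ∀ p ∈ S, ∃ (φ : OpenPartialHomeomorph P E) (F : Submodule ℝ E),
    IsSliceChart S p φ F ∧ Module.finrank ℝ F = k

variable (E) in
/-- The tangent space `T_p S ⊆ T_p P` of an embedded submanifold `S` at a point `p` of `S`: the
vectors that are tangent to `S` in the slice charts around `p`. All slice charts give the same
subspace, see `submanifoldTangent_eq`. -/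
def submanifoldTangent (S : Set P) (p : P) : Submodule ℝ (TangentSpace 𝓘(ℝ, E) p) :=
  ⨅ (φ : OpenPartialHomeomorph P E) (F : Submodule ℝ E) (_ : IsSliceChart S p φ F),
    F.comap (mfderiv 𝓘(ℝ, E) 𝓘(ℝ, E) φ p).toLinearMap

/-- Two slice charts define the same tangent vectors. -/
theorem IsSliceChart.mem_of_mem [IsManifold 𝓘(ℝ, E) ∞ P] [FiniteDimensional ℝ E] {S : Set P}
    {p : P} (hp : p ∈ S) {φ ψ : OpenPartialHomeomorph P E} {F G : Submodule ℝ E}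
    (hφ : IsSliceChart S p φ F) (hψ : IsSliceChart S p ψ G) {v : TangentSpace 𝓘(ℝ, E) p}
    (hv : mfderiv 𝓘(ℝ, E) 𝓘(ℝ, E) φ p v ∈ F) : mfderiv 𝓘(ℝ, E) 𝓘(ℝ, E) ψ p v ∈ G := by
  have h1 : (1 : WithTop ℕ∞) ≤ ∞ := by norm_cast
  have hφ1 := IsManifold.maximalAtlas_subset_of_le h1 hφ.mem_maximalAtlas
  have hψ1 := IsManifold.maximalAtlas_subset_of_le h1 hψ.mem_maximalAtlas
  have hφd := mdifferentiableAt_of_mem_maximalAtlas hφ1 hφ.mem_source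
  have hψd := mdifferentiableAt_of_mem_maximalAtlas hψ1 hψ.mem_source
  have hsd := mdifferentiableAt_symm_of_mem_maximalAtlas hφ1 (φ.map_source hφ.mem_source)
  set g : E → E := ψ ∘ φ.symm with hg
  have hψd' : MDifferentiableAt 𝓘(ℝ, E) 𝓘(ℝ, E) ψ (φ.symm (φ p)) := by
    rwa [φ.left_inv hφ.mem_source]
  have hgd : DifferentiableAt ℝ g (φ p) :=
    mdifferentiableAt_iff_differentiableAt.1 (hψd'.comp (φ p) hsd)
  have hchain : fderiv ℝ g (φ p) (mfderiv 𝓘(ℝ, E) 𝓘(ℝ, E) φ p v) =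
      mfderiv 𝓘(ℝ, E) 𝓘(ℝ, E) ψ p v := by
    have hgd' : MDifferentiableAt 𝓘(ℝ, E) 𝓘(ℝ, E) g (φ p) := hψd'.comp (φ p) hsd
    have h2 := mfderiv_comp p hgd' hφd
    have h3 : mfderiv 𝓘(ℝ, E) 𝓘(ℝ, E) (g ∘ φ) p = mfderiv 𝓘(ℝ, E) 𝓘(ℝ, E) ψ p := by
      apply Filter.EventuallyEq.mfderiv_eq
      filter_upwards [φ.open_source.mem_nhds hφ.mem_source] with q hq
      simp [hg, φ.left_inv hq]
    rw [← h3, h2, mfderiv_eq_fderiv]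
    rfl
  set w : E := mfderiv 𝓘(ℝ, E) 𝓘(ℝ, E) φ p v with hw
  have hline : HasDerivAt (fun t : ℝ ↦ φ p + t • w) w 0 := by
    simpa using ((hasDerivAt_id (0 : ℝ)).smul_const w).const_add (φ p)
  have hcurve : HasDerivAt (fun t : ℝ ↦ g (φ p + t • w)) (fderiv ℝ g (φ p) w) 0 := by
    have hgd0 : HasFDerivAt g (fderiv ℝ g (φ p)) (φ p + (0 : ℝ) • w) := by
      simpa using hgd.hasFDerivAt
    exact hgd0.comp_hasDerivAt 0 hline
  have hcont : Filter.Tendsto (fun t : ℝ ↦ φ p + t • w) (nhds 0) (nhds (φ p)) := by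
    simpa using hline.continuousAt.tendsto
  have hmem : ∀ᶠ t : ℝ in nhds 0, g (φ p + t • w) ∈ G := by
    have ht := hcont.eventually (φ.open_target.mem_nhds (φ.map_source hφ.mem_source))
    have hs : ContinuousAt φ.symm (φ p) := φ.continuousAt_symm (φ.map_source hφ.mem_source)
    have hs' : Filter.Tendsto (fun t : ℝ ↦ φ.symm (φ p + t • w)) (nhds 0) (nhds p) := by
      have := hs.tendsto.comp hcont
      rwa [φ.left_inv hφ.mem_source] at this
    filter_upwards [ht, hs'.eventually (ψ.open_source.mem_nhds hψ.mem_source)] with t h4 h5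
    refine (hψ.mem_iff _ h5).1 ((hφ.mem_iff _ (φ.map_target h4)).2 ?_)
    rw [φ.right_inv h4]
    exact F.add_mem ((hφ.mem_iff p hφ.mem_source).1 hp) (F.smul_mem t hv)
  rw [← hchain]
  have hclosed : IsClosed (G : Set E) := G.closed_of_finiteDimensional
  have hslope := hcurve.tendsto_slope_zero
  refine hclosed.mem_of_tendsto hslope ?_
  filter_upwards [hmem.filter_mono nhdsWithin_le_nhds] with t ht
  refine G.smul_mem _ (G.sub_mem (by simpa using ht) ?_)
  simpa using hmem.self_of_nhds

theorem submanifoldTangent_eq [IsManifold 𝓘(ℝ, E) ∞ P] [FiniteDimensional ℝ E] {S : Set P}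
    {p : P} (hp : p ∈ S) {φ : OpenPartialHomeomorph P E} {F : Submodule ℝ E}
    (hφ : IsSliceChart S p φ F) :
    submanifoldTangent E S p = F.comap (mfderiv 𝓘(ℝ, E) 𝓘(ℝ, E) φ p).toLinearMap := by
  apply le_antisymm
  · exact iInf_le_of_le φ (iInf_le_of_le F (iInf_le_of_le hφ le_rfl))
  · exact le_iInf fun ψ ↦ le_iInf fun G ↦ le_iInf fun hψ v hv ↦ hφ.mem_of_mem hp hψ hv

end Submanifold

/-! ### Poisson manifolds -/

section Poisson

variable (E : Type*) [NormedAddCommGroup E] [NormedSpace ℝ E]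
  (P : Type*) [TopologicalSpace P] [ChartedSpace E P]

variable {P} in
/-- The covector field `d (ξ ∘ φ)` near `p`, where `φ` is the preferred chart at `p`: the covector
field with the constant coefficients `ξ` in this chart. -/
def chartCovector (p : P) (ξ : Module.Dual ℝ E) (q : P) :
    Module.Dual ℝ (TangentSpace 𝓘(ℝ, E) q) :=
  ξ ∘ₗ (mfderiv 𝓘(ℝ, E) 𝓘(ℝ, E) (chartAt E p) q).toLinearMap

/-- A smooth bivector field on `P`: a field of alternating bilinear forms on the cotangent spaces
whose coefficients in charts are smooth. -/
structure BivectorField where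
  toFun (p : P) : Module.Dual ℝ (TangentSpace 𝓘(ℝ, E) p) →ₗ[ℝ]
    Module.Dual ℝ (TangentSpace 𝓘(ℝ, E) p) →ₗ[ℝ] ℝ
  alternating (p : P) (ξ : Module.Dual ℝ (TangentSpace 𝓘(ℝ, E) p)) : toFun p ξ ξ = 0
  contMDiffOn (p : P) (ξ η : Module.Dual ℝ E) : ContMDiffOn 𝓘(ℝ, E) 𝓘(ℝ, ℝ) ∞
    (fun q ↦ toFun q (chartCovector E p ξ q) (chartCovector E p η q)) (chartAt E p).source

variable {E P}

instance [FiniteDimensional ℝ E] (p : P) : FiniteDimensional ℝ (TangentSpace 𝓘(ℝ, E) p) :=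
  inferInstanceAs (FiniteDimensional ℝ E)

namespace BivectorField

variable [FiniteDimensional ℝ E]

/-- The contraction `♯ : T_p* P → T_p P` with a bivector field. -/
def sharp (B : BivectorField E P) (p : P) :
    Module.Dual ℝ (TangentSpace 𝓘(ℝ, E) p) →ₗ[ℝ] TangentSpace 𝓘(ℝ, E) p :=
  PoissonLinear.sharp (B.toFun p)

theorem isSkew_sharp (B : BivectorField E P) (p : P) : PoissonLinear.IsSkew (B.sharp p) := by
  intro ξ
  rw [sharp, PoissonLinear.apply_sharp]
  exact B.alternating p ξ

/-- The trivector `[B, B]` at `p` for the Schouten bracket, evaluated on three covectors with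
coefficients `ξ`, `η`, `ζ` in the preferred chart at `p`. In coordinates,
`[B, B]^{ijk} = 2 ∑_l (B^{il} ∂_l B^{jk} + B^{jl} ∂_l B^{ki} + B^{kl} ∂_l B^{ij})`, up to a sign
that depends on conventions. -/
def schoutenSquare (B : BivectorField E P) (p : P) (ξ η ζ : Module.Dual ℝ E) : ℝ :=
  let coeff (α β : Module.Dual ℝ E) (q : P) : ℝ :=
    B.toFun q (chartCovector E p α q) (chartCovector E p β q)
  let D (α β γ : Module.Dual ℝ E) : ℝ :=
    mfderiv 𝓘(ℝ, E) 𝓘(ℝ, ℝ) (coeff β γ) p (B.sharp p (chartCovector E p α p))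
  2 * (D ξ η ζ + D η ζ ξ + D ζ ξ η)

end BivectorField

variable (E P) in
/-- A Poisson structure on `P`: a smooth bivector field `B` with `[B, B] = 0`. -/
structure PoissonStructure [FiniteDimensional ℝ E] extends BivectorField E P where
  schouten_eq_zero (p : P) (ξ η ζ : Module.Dual ℝ E) :
    toBivectorField.schoutenSquare p ξ η ζ = 0

namespace PoissonStructure

variable [FiniteDimensional ℝ E]

/-- `♯ N_p* S`, where the conormal space `N_p* S` is the annihilator of `T_p S` in `T_p* P`. -/
def sharpConormal (B : PoissonStructure E P) (S : Set P) (p : P) :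
    Submodule ℝ (TangentSpace 𝓘(ℝ, E) p) :=
  PoissonLinear.sharpAnn (B.sharp p) (submanifoldTangent E S p)

/-- A submanifold `S` is pre-Poisson if `TS + ♯ N*S` has constant rank along `S`. -/
def IsPrePoisson (B : PoissonStructure E P) (S : Set P) : Prop :=
  ∃ r : ℕ, ∀ p ∈ S, Module.finrank ℝ ↥(submanifoldTangent E S p ⊔ B.sharpConormal S p) = r

/-- A submanifold `S` is cosymplectic if `T_p P = T_p S ⊕ ♯ N_p* S` for all points `p` of `S`. -/
def IsCosymplectic (B : PoissonStructure E P) (S : Set P) : Prop :=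
  ∀ p ∈ S, PoissonLinear.IsCosymplectic (B.sharp p) (submanifoldTangent E S p)

/-- For a cosymplectic submanifold `S`, the sharp map `T_p* S → T_p S` of the Poisson structure
induced on `S`. -/
def submanifoldSharp (B : PoissonStructure E P) {S : Set P} (hS : B.IsCosymplectic S)
    (p : P) (hp : p ∈ S) :
    Module.Dual ℝ (submanifoldTangent E S p) →ₗ[ℝ] submanifoldTangent E S p :=
  PoissonLinear.inducedSharp (B.isSkew_sharp p) (hS p hp)

/-- A submanifold `C` of `P` that is contained in a cosymplectic submanifold `S` is coisotropic
in `S` if `♯_S` maps the annihilator of `T_p C` in `T_p* S` into `T_p C`, for all points `p`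
of `C`. -/
def IsCoisotropicIn (B : PoissonStructure E P) {C S : Set P} (hCS : C ⊆ S)
    (hS : B.IsCosymplectic S) : Prop :=
  ∀ (p : P) (hp : p ∈ C), PoissonLinear.IsCoisotropic (B.submanifoldSharp hS p (hCS hp))
    ((submanifoldTangent E C p).comap (submanifoldTangent E S p).subtype)

end PoissonStructure

end Poisson
end

open Filter Topology

/-!
Near `C` choose a smooth map `f` with values in a Banach space that vanishes on `C` and satisfies
`ker d_p f = T_p C` for `p ∈ C`. Then `K_p = d_p f (♯ N_p* C)` has rank `r - k` for all `p ∈ C`,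
where `r` is the rank of `TC + ♯ N*C`, so there are local smooth families of projections onto the
spaces `K_p`. They can be averaged by a partition of unity, because being a projection onto a given
subspace is a convex condition. This gives a smooth operator field `N` near `C`, and for `p ∈ C`
linear algebra shows that `ker (N_p ∘ d_p f)` is cosymplectic and contains `T_p C` as a
coisotropic subspace.

A smooth retraction onto the idempotents replaces `N` by a field of idempotents `Ψ` near `C` without
changing it on `C`. For idempotents the equation `Ψ_q (f q) = 0` is, near each `p ∈ C`, equivalent
to `Ψ_p (Ψ_q (f q)) = 0`, a submersion onto the range of `Ψ_p`. So it defines a submanifold near `C`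
with tangent space `ker (N_p ∘ d_p f)` at `p ∈ C`. Cosymplecticity is an open condition, so a
neighbourhood of `C` in this submanifold is the required one.
-/

/-! ### Linear algebra -/

namespace PoissonLinear

variable {V : Type*} [AddCommGroup V] [Module ℝ V]
  {s : Module.Dual ℝ V →ₗ[ℝ] V} {T W : Submodule ℝ V}

theorem isCosymplectic_iff_forall_eq_zero [FiniteDimensional ℝ V] :
    IsCosymplectic s T ↔ ∀ ξ ∈ T.dualAnnihilator, s ξ ∈ T → ξ = 0 := by
  let r : T.dualAnnihilator →ₗ[ℝ] V ⧸ T := T.mkQ ∘ₗ s.domRestrict T.dualAnnihilator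
  have hdim : Module.finrank ℝ T.dualAnnihilator = Module.finrank ℝ (V ⧸ T) := by
    have h₁ := Subspace.finrank_add_finrank_dualAnnihilator_eq T
    have h₂ := Submodule.finrank_quotient_add_finrank T
    lia
  have hinj : Function.Injective r ↔ ∀ ξ ∈ T.dualAnnihilator, s ξ ∈ T → ξ = 0 := by
    refine (LinearMap.ker_eq_bot (M := T.dualAnnihilator)).symm.trans ?_
    simp only [LinearMap.ker_eq_bot', r, Subtype.forall, LinearMap.comp_apply,
      LinearMap.domRestrict_apply, Submodule.mkQ_apply, Submodule.Quotient.mk_eq_zero,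
      Submodule.mk_eq_zero]
  have hsurj : Function.Surjective r ↔ Codisjoint T (sharpAnn s T) := by
    rw [← LinearMap.range_eq_top, LinearMap.range_comp, LinearMap.range_domRestrict,
      Submodule.map_mkQ_eq_top, codisjoint_iff, sharpAnn]
  have hiff : Codisjoint T (sharpAnn s T) ↔ ∀ ξ ∈ T.dualAnnihilator, s ξ ∈ T → ξ = 0 := by
    rw [← hsurj, ← hinj]
    exact (LinearMap.injective_iff_surjective_of_finrank_eq_finrank (V := T.dualAnnihilator)
      hdim).symm
  refine ⟨fun h ↦ hiff.1 h.codisjoint, fun h ↦ ⟨Submodule.disjoint_def.2 ?_, hiff.2 h⟩⟩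
  rintro _ hT ⟨ξ, hξ, rfl⟩
  rw [h ξ hξ hT, map_zero]

theorem isCosymplectic_iff_det_ne_zero [FiniteDimensional ℝ V] {ι : Type*} [Fintype ι]
    [DecidableEq ι] {ξ : ι → Module.Dual ℝ V} (hξ : LinearIndependent ℝ ξ)
    (hT : T.dualAnnihilator = Submodule.span ℝ (Set.range ξ)) :
    IsCosymplectic s T ↔ (Matrix.of fun i j ↦ ξ i (s (ξ j))).det ≠ 0 := by
  have hmem (v : V) : v ∈ T ↔ ∀ i, ξ i v = 0 := by
    rw [← Subspace.forall_mem_dualAnnihilator_apply_eq_zero_iff T v, hT]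
    refine ⟨fun h i ↦ h _ (Submodule.subset_span ⟨i, rfl⟩), fun h η hη ↦ ?_⟩
    exact (Submodule.span_le (p := LinearMap.ker (Module.Dual.eval ℝ V v))).2
      (Set.range_subset_iff.2 h) hη
  have hker (c : ι → ℝ) : s (∑ j, c j • ξ j) ∈ T ↔
      (Matrix.of fun i j ↦ ξ i (s (ξ j))).mulVec c = 0 := by
    simp only [hmem, funext_iff, Matrix.mulVec, dotProduct, map_sum, map_smul, smul_eq_mul,
      Matrix.of_apply, Pi.zero_apply, mul_comm]
  rw [isCosymplectic_iff_forall_eq_zero, ne_eq, ← Matrix.exists_mulVec_eq_zero_iff, hT]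
  simp only [Submodule.mem_span_range_iff_exists_fun, forall_exists_index,
    forall_apply_eq_imp_iff, hker, not_exists, not_and]
  refine forall_congr' fun c ↦ ?_
  have hzero : ∑ j, c j • ξ j = 0 ↔ c = 0 :=
    ⟨fun h ↦ funext (Fintype.linearIndependent_iff.1 hξ c h), fun h ↦ by simp [h]⟩
  rw [hzero, ne_eq, not_imp_not]

/-- `T ⊇ W` meets `♯ W°` inside `W` and spans `V` together with it. For skew `s` these are exactly
the conditions that make `T` cosymplectic and `W` coisotropic in `T`. -/
structure IsCosymplecticExtension (s : Module.Dual ℝ V →ₗ[ℝ] V) (W T : Submodule ℝ V) : Prop where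
  le : W ≤ T
  inf_le : T ⊓ sharpAnn s W ≤ W
  sup_eq_top : T ⊔ sharpAnn s W = ⊤

theorem IsCosymplecticExtension.isCosymplectic [FiniteDimensional ℝ V]
    (h : IsCosymplecticExtension s W T) (hs : IsSkew s) : IsCosymplectic s T := by
  refine isCosymplectic_iff_forall_eq_zero.2 fun ξ hξ hsξ ↦ ?_
  have hsξW : s ξ ∈ W := h.inf_le ⟨hsξ, ξ, Submodule.dualAnnihilator_anti h.le hξ, rfl⟩
  have hξ_sharp : sharpAnn s W ≤ LinearMap.ker ξ := by
    rintro _ ⟨η, hη, rfl⟩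
    rw [LinearMap.mem_ker, hs.apply_eq_neg, (Submodule.mem_dualAnnihilator η).1 hη _ hsξW,
      neg_zero]
  have hξ_top : T ⊔ sharpAnn s W ≤ LinearMap.ker ξ :=
    sup_le (fun v hv ↦ (Submodule.mem_dualAnnihilator ξ).1 hξ v hv) hξ_sharp
  rwa [h.sup_eq_top, top_le_iff, LinearMap.ker_eq_top] at hξ_top

theorem IsCosymplecticExtension.isCoisotropic (h : IsCosymplecticExtension s W T) (hs : IsSkew s)
    (hT : IsCosymplectic s T) : IsCoisotropic (inducedSharp hs hT) (W.comap T.subtype) := by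
  rintro _ ⟨ξ, hξ, rfl⟩
  refine h.inf_le ⟨sharp_extendCovector_mem hs hT ξ, extendCovector hT ξ, ?_, rfl⟩
  refine (Submodule.mem_dualAnnihilator _).2 fun w hw ↦ ?_
  have hext : extendCovector hT ξ w = ξ ⟨w, h.le hw⟩ :=
    congrArg ξ (Submodule.projectionOnto_apply_left hT ⟨w, h.le hw⟩)
  rw [hext]
  exact (Submodule.mem_dualAnnihilator ξ).1 hξ ⟨w, h.le hw⟩ hw

section Projection

variable {X : Type*} [AddCommGroup X] [Module ℝ X] {g : V →ₗ[ℝ] X} {N : X →ₗ[ℝ] X}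
  {U : Submodule ℝ V}

theorem ker_comp_inf_le (hN : LinearMap.IsProj (U.map g) N) :
    LinearMap.ker (N ∘ₗ g) ⊓ U ≤ LinearMap.ker g := by
  rintro v ⟨hv, hvU⟩
  rw [LinearMap.mem_ker, ← hN.map_id (g v) ⟨v, hvU, rfl⟩]
  exact hv

theorem ker_comp_sup_eq_top (hN : LinearMap.IsProj (U.map g) N) :
    LinearMap.ker (N ∘ₗ g) ⊔ U = ⊤ := by
  refine eq_top_iff.2 fun v _ ↦ ?_
  obtain ⟨u, hu, huv⟩ := hN.map_mem (g v)
  refine Submodule.mem_sup.2 ⟨v - u, ?_, u, hu, sub_add_cancel v u⟩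
  rw [LinearMap.mem_ker, LinearMap.comp_apply, map_sub, map_sub,
    hN.map_id (g u) ⟨u, hu, rfl⟩, huv, sub_self]

theorem isCosymplecticExtension_ker_comp
    (hN : LinearMap.IsProj ((sharpAnn s (LinearMap.ker g)).map g) N) :
    IsCosymplecticExtension s (LinearMap.ker g) (LinearMap.ker (N ∘ₗ g)) :=
  ⟨LinearMap.ker_le_ker_comp g N, ker_comp_inf_le hN, ker_comp_sup_eq_top hN⟩

end Projection

end PoissonLinear

theorem finrank_map_add_finrank_ker {K V V' : Type*} [DivisionRing K] [AddCommGroup V] [Module K V]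
    [FiniteDimensional K V] [AddCommGroup V'] [Module K V'] (g : V →ₗ[K] V')
    (U : Submodule K V) :
    Module.finrank K (U.map g) + Module.finrank K (LinearMap.ker g) =
      Module.finrank K ↥(LinearMap.ker g ⊔ U) := by
  have hmap : U.map g = (LinearMap.ker g ⊔ U).map g := by
    rw [Submodule.map_sup, LinearMap.le_ker_iff_map.1 le_rfl, bot_sup_eq]
  have hker : Module.finrank K (LinearMap.ker (g.domRestrict (LinearMap.ker g ⊔ U))) =
      Module.finrank K (LinearMap.ker g) := by
    rw [LinearMap.ker_domRestrict]
    exact (Submodule.submoduleOfEquivOfLe le_sup_left).finrank_eq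
  rw [hmap, ← LinearMap.range_domRestrict, ← hker, LinearMap.finrank_range_add_finrank_ker]

theorem dualAnnihilator_comap_eq_map_dualMap {K V V' : Type*} [Field K] [AddCommGroup V]
    [Module K V] [AddCommGroup V'] [Module K V'] (A : V →ₗ[K] V') (F : Submodule K V') :
    (F.comap A).dualAnnihilator = F.dualAnnihilator.map A.dualMap := by
  have hF : (F.comap A) = LinearMap.ker (F.mkQ ∘ₗ A) := by rw [LinearMap.ker_comp, F.ker_mkQ]
  rw [hF, ← LinearMap.range_dualMap_eq_dualAnnihilator_ker, ← LinearMap.dualMap_comp_dualMap,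
    LinearMap.range_comp, LinearMap.range_dualMap_eq_dualAnnihilator_ker, F.ker_mkQ]

/-! ### Idempotents in Banach algebras -/

section Idempotent

variable (A : Type*) [NormedRing A] [NormedAlgebra ℝ A] [CompleteSpace A]

theorem exists_contDiffAt_sqrt_nhds_one : ∃ ψ : A → A, ψ 1 = 1 ∧
    (∀ᶠ y in 𝓝 (1 : A), ψ y * ψ y = y) ∧ (∀ᶠ z in 𝓝 (1 : A), ψ (z * z) = z) ∧
    ∀ᶠ y in 𝓝 (1 : A), ContDiffAt ℝ ∞ ψ y := by
  let D : A ≃L[ℝ] A := ContinuousLinearEquiv.smulLeft (Units.mk0 (2 : ℝ) two_ne_zero)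
  have hf : ContDiffAt ℝ ω (fun z : A ↦ z * z) 1 := (contDiff_id.mul contDiff_id).contDiffAt
  have hf' : HasFDerivAt (fun z : A ↦ z * z) (D : A →L[ℝ] A) 1 := by
    refine ((hasFDerivAt_id (𝕜 := ℝ) (1 : A)).mul' (hasFDerivAt_id (1 : A))).congr_fderiv ?_
    ext x
    simp [D, two_smul]
  have hω : (ω : WithTop ℕ∞) ≠ 0 := by simp
  have hs := hf.hasStrictFDerivAt' hf' hω
  refine ⟨hf.localInverse hf' hω, ?_, ?_, hs.eventually_left_inverse, ?_⟩
  · simpa using hf.localInverse_apply_image hf' hω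
  · have h := hs.eventually_right_inverse
    rwa [mul_one] at h
  · have h := (hf.to_localInverse hf' hω).eventually (by simp)
    rw [mul_one] at h
    exact h.mono fun y hy ↦ hy.of_le le_top

theorem exists_involution_correction : ∃ τ : A → A, ∀ n₀ : A, n₀ * n₀ = 1 →
    τ n₀ = n₀ ∧ ∀ᶠ n in 𝓝 n₀, τ n * τ n = 1 ∧ ContDiffAt ℝ ∞ τ n := by
  obtain ⟨ψ, hψ_one, hψ_sq, hψ_left, hψ_smooth⟩ := exists_contDiffAt_sqrt_nhds_one A
  let y : A → A := fun n ↦ Ring.inverse (n * n)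
  refine ⟨fun n ↦ n * ψ (y n), fun n₀ hn₀ ↦ ?_⟩
  have hy₀ : y n₀ = 1 := by simp [y, hn₀]
  have hy_smooth (u : Aˣ) : ContDiffAt ℝ ∞ y u :=
    ContDiffAt.comp (g := Ring.inverse) (f := fun n ↦ n * n) (u : A)
      (contDiffAt_ringInverse ℝ (u * u)) (contDiffAt_id.mul contDiffAt_id)
  obtain ⟨u₀, rfl⟩ : IsUnit n₀ := ⟨⟨n₀, n₀, hn₀, hn₀⟩, rfl⟩
  have hy_tendsto : Tendsto y (𝓝 u₀) (𝓝 1) := hy₀ ▸ (hy_smooth u₀).continuousAt.tendsto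
  have hψy_tendsto : Tendsto (fun n ↦ ψ (y n)) (𝓝 u₀) (𝓝 1) := by
    have h := hψ_smooth.self_of_nhds.continuousAt.tendsto.comp hy_tendsto
    rwa [hψ_one] at h
  have hconj : Tendsto (fun n ↦ n * ψ (y n) * Ring.inverse n) (𝓝 u₀) (𝓝 1) := by
    simpa using (tendsto_id.mul hψy_tendsto).mul (NormedRing.inverse_continuousAt u₀).tendsto
  refine ⟨by simp [hy₀, hψ_one], ?_⟩
  filter_upwards [hy_tendsto.eventually hψ_sq, hy_tendsto.eventually hψ_smooth,
    hconj.eventually hψ_left, Units.isOpen.mem_nhds u₀.isUnit] with n hsq hsmooth hleft hn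
  obtain ⟨u, rfl⟩ := hn
  have hyu : y u = ↑(u⁻¹ * u⁻¹) := by simp [y, ← Units.val_mul]
  -- Conjugation by `u` fixes `y u`, hence its square root near `1`, which is unique.
  have hconj_sq : u * ψ (y u) * Ring.inverse ↑u * (u * ψ (y u) * Ring.inverse ↑u) = y u := by
    calc _ = u * (ψ (y u) * ψ (y u)) * ↑u⁻¹ := by simp [mul_assoc]
      _ = y u := by rw [hsq, hyu]; simp
  have hcomm : Commute (u : A) (ψ (y u)) := by
    rw [hconj_sq, Ring.inverse_unit] at hleft
    rw [commute_iff_eq, ← u.mul_inv_eq_iff_eq_mul, ← hleft]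
  refine ⟨?_, contDiffAt_id.mul (hsmooth.comp (u : A) (hy_smooth u))⟩
  rw [hcomm.symm.mul_mul_mul_comm, hsq, hyu, ← Units.val_mul, ← Units.val_mul]
  simp

theorem exists_idempotent_correction : ∃ σ : A → A, ∀ e : A, IsIdempotentElem e →
    σ e = e ∧ ∀ᶠ a in 𝓝 e, IsIdempotentElem (σ a) ∧ ContDiffAt ℝ ∞ σ a := by
  obtain ⟨τ, hτ⟩ := exists_involution_correction A
  let n : A → A := fun a ↦ (2 : ℝ) • a - 1
  have hn : ContDiff ℝ ∞ n := by fun_prop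
  refine ⟨fun a ↦ (2⁻¹ : ℝ) • (1 + τ (n a)), fun e he ↦ ?_⟩
  have hne : n e * n e = 1 := by
    simp only [n, sub_mul, mul_sub, he.eq, one_mul, mul_one, smul_mul_assoc, mul_smul_comm]
    module
  obtain ⟨hfix, hnear⟩ := hτ (n e) hne
  refine ⟨by simp [hfix, n], ?_⟩
  filter_upwards [hn.continuous.continuousAt.eventually hnear] with a ⟨hinv, hsmooth⟩
  refine ⟨?_, (contDiffAt_const.add (hsmooth.comp a hn.contDiffAt)).const_smul _⟩
  rw [IsIdempotentElem, smul_mul_smul_comm, add_mul, mul_add, mul_add, hinv]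
  simp only [one_mul, mul_one]
  module

end Idempotent

/-! ### Smooth families of projections -/

section Projection

variable {G X : Type*} [NormedAddCommGroup G] [NormedSpace ℝ G]
  [NormedAddCommGroup X] [NormedSpace ℝ X]

theorem isProj_range_comp_inverse_comp {L : G →L[ℝ] X} {R : X →L[ℝ] G} (h : IsUnit (R ∘L L)) :
    LinearMap.IsProj L.range (L ∘L Ring.inverse (R ∘L L) ∘L R) := by
  refine ⟨fun x ↦ ⟨_, rfl⟩, ?_⟩
  rintro _ ⟨c, rfl⟩
  exact congrArg L (DFunLike.congr_fun (Ring.inverse_mul_cancel _ h) c)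

variable {E : Type*} [NormedAddCommGroup E] [NormedSpace ℝ E]
  {P : Type*} [TopologicalSpace P] [ChartedSpace E P]

theorem exists_contMDiffAt_isProj_range [CompleteSpace G] {L : P → G →L[ℝ] X} {p : P}
    (hL : ∀ᶠ q in 𝓝 p, ContMDiffAt 𝓘(ℝ, E) 𝓘(ℝ, G →L[ℝ] X) ∞ L q)
    (hinj : (L p).HasLeftInverse) :
    ∃ N : P → X →L[ℝ] X, ∀ᶠ q in 𝓝 p,
      ContMDiffAt 𝓘(ℝ, E) 𝓘(ℝ, X →L[ℝ] X) ∞ N q ∧ LinearMap.IsProj (L q).range (N q) := by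
  obtain ⟨R, hR⟩ := hinj
  have hRLp : R ∘L L p = 1 := ContinuousLinearMap.ext hR
  have hRL : ContinuousAt (fun q ↦ R ∘L L q) p :=
    continuousAt_const.clm_comp hL.self_of_nhds.continuousAt
  have hunit : ∀ᶠ q in 𝓝 p, IsUnit (R ∘L L q) :=
    hRL.eventually (Units.isOpen.mem_nhds (by simpa only [hRLp] using! isUnit_one))
  refine ⟨fun q ↦ L q ∘L Ring.inverse (R ∘L L q) ∘L R, ?_⟩
  filter_upwards [hL, hunit] with q hLq hq
  refine ⟨?_, isProj_range_comp_inverse_comp hq⟩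
  have hinv : ContMDiffAt 𝓘(ℝ, E) 𝓘(ℝ, G →L[ℝ] G) ∞ (fun q ↦ Ring.inverse (R ∘L L q)) q := by
    obtain ⟨u, hu⟩ := hq
    have h := contDiffAt_ringInverse ℝ (n := ∞) u
    rw [hu] at h
    exact h.contMDiffAt.comp q (contMDiffAt_const.clm_comp hLq)
  exact hLq.clm_comp (hinv.clm_comp contMDiffAt_const)

theorem exists_contMDiffAt_isProj_span [CompleteSpace X] {ι : Type*} [Finite ι] {u : ι → P → X}
    {p : P}
    (hu : ∀ i, ∀ᶠ q in 𝓝 p, ContMDiffAt 𝓘(ℝ, E) 𝓘(ℝ, X) ∞ (u i) q)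
    (hli : LinearIndependent ℝ fun i ↦ u i p) :
    ∃ N : P → X →L[ℝ] X, ∀ᶠ q in 𝓝 p, ContMDiffAt 𝓘(ℝ, E) 𝓘(ℝ, X →L[ℝ] X) ∞ N q ∧
      LinearMap.IsProj (Submodule.span ℝ (Set.range fun i ↦ u i q)) (N q) := by
  classical
  have := Fintype.ofFinite ι
  let Λ : (ι → X) ≃L[ℝ] (ι → ℝ) →L[ℝ] X := (ContinuousLinearEquiv.piRing ι).symm
  have hΛ (x : ι → X) : (Λ x : (ι → ℝ) →ₗ[ℝ] X) = Fintype.linearCombination ℝ x :=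
    LinearMap.ext fun c ↦ LinearEquiv.piRing_symm_apply ℝ x c
  have hsmooth : ∀ᶠ q in 𝓝 p,
      ContMDiffAt 𝓘(ℝ, E) 𝓘(ℝ, (ι → ℝ) →L[ℝ] X) ∞ (fun q ↦ Λ fun i ↦ u i q) q := by
    filter_upwards [eventually_all.2 hu] with q hq
    exact Λ.contDiff.contMDiff.contMDiffAt.comp q (contMDiffAt_pi_space.2 hq)
  have hinj : (Λ fun i ↦ u i p).HasLeftInverse := by
    refine .of_injective_of_isClosed_range_of_closedComplement_range ?_ ?_
      (.of_finiteDimensional _)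
    · rw [← ContinuousLinearMap.coe_coe, hΛ]
      exact hli.fintypeLinearCombination_injective
    · exact Submodule.closed_of_finiteDimensional (LinearMap.range (Λ fun i ↦ u i p).toLinearMap)
  obtain ⟨N, hN⟩ := exists_contMDiffAt_isProj_range hsmooth hinj
  refine ⟨N, hN.mono fun q hq ↦ ?_⟩
  rw [← Fintype.range_linearCombination, ← hΛ]
  exact hq

theorem exists_contMDiffAt_isProj_of_finrank_eq [CompleteSpace X] {ι : Type*} [Finite ι]
    {u : ι → P → X} {K : P → Submodule ℝ X} {C : Set P} {p : P} {d : ℕ} (hp : p ∈ C)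
    (hu : ∀ i, ∀ᶠ q in 𝓝 p, ContMDiffAt 𝓘(ℝ, E) 𝓘(ℝ, X) ∞ (u i) q)
    (hK : ∀ᶠ q in 𝓝[C] p, K q = Submodule.span ℝ (Set.range fun i ↦ u i q))
    (hd : ∀ q ∈ C, Module.finrank ℝ (K q) = d) :
    ∃ N : P → X →L[ℝ] X, ∀ᶠ q in 𝓝 p, ContMDiffAt 𝓘(ℝ, E) 𝓘(ℝ, X →L[ℝ] X) ∞ N q ∧
      (q ∈ C → LinearMap.IsProj (K q) (N q)) := by
  obtain ⟨κ, a, ha, hspan, hli⟩ := exists_linearIndependent' ℝ fun i ↦ u i p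
  have := Finite.of_injective a ha
  have := Fintype.ofFinite κ
  obtain ⟨N, hN⟩ := exists_contMDiffAt_isProj_span (u := fun j ↦ u (a j)) (fun j ↦ hu (a j)) hli
  have hli_near : ∀ᶠ q in 𝓝 p, LinearIndependent ℝ fun j ↦ u (a j) q :=
    (continuousAt_pi.2 fun j ↦ (hu (a j)).self_of_nhds.continuousAt).eventually hli.eventually
  have hcard : Fintype.card κ = d := by
    rw [← hd p hp, hK.self_of_nhdsWithin hp, ← hspan, finrank_span_eq_card hli]
  refine ⟨N, ?_⟩
  filter_upwards [hN, hli_near, eventually_nhdsWithin_iff.1 hK] with q ⟨hsmooth, hproj⟩ hliq hKq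
  refine ⟨hsmooth, fun hq ↦ ?_⟩
  have hle : Submodule.span ℝ (Set.range fun j ↦ u (a j) q) ≤ K q := by
    rw [hKq hq]
    exact Submodule.span_mono (Set.range_comp_subset_range a fun i ↦ u i q)
  have : FiniteDimensional ℝ (K q) :=
    hKq hq ▸ FiniteDimensional.span_of_finite ℝ (Set.finite_range _)
  rwa [← Submodule.eq_of_le_of_finrank_eq hle]
  rw [hd q hq, finrank_span_eq_card hliq, hcard]

end Projection

/-! ### Slice charts of zero sets -/

section InverseFunction

variable {E : Type*} [NormedAddCommGroup E] [NormedSpace ℝ E] [CompleteSpace E]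

theorem exists_openPartialHomeomorph_contDiffOn {θ : E → E} {x₀ : E}
    (hθ : ∀ᶠ x in 𝓝 x₀, ContDiffAt ℝ ∞ θ x) (hunit : IsUnit (fderiv ℝ θ x₀))
    {s : Set E} (hs : s ∈ 𝓝 x₀) :
    ∃ e : OpenPartialHomeomorph E E, ⇑e = θ ∧ x₀ ∈ e.source ∧ e.source ⊆ s ∧
      ContDiffOn ℝ ∞ e e.source ∧ ContDiffOn ℝ ∞ e.symm e.target := by
  have hne : (∞ : WithTop ℕ∞) ≠ 0 := by simp
  have hθ₀ := hθ.self_of_nhds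
  have hderiv {x : E} (hx : ContDiffAt ℝ ∞ θ x) {u : (E →L[ℝ] E)ˣ} (hu : u = fderiv ℝ θ x) :
      HasFDerivAt θ (ContinuousLinearEquiv.unitsEquiv ℝ E u : E →L[ℝ] E) x :=
    (hx.differentiableAt hne).hasFDerivAt.congr_fderiv hu.symm
  obtain ⟨u₀, hu₀⟩ := hunit
  let e := hθ₀.toOpenPartialHomeomorph θ (hderiv hθ₀ hu₀) hne
  have hunit_near : ∀ᶠ x in 𝓝 x₀, IsUnit (fderiv ℝ θ x) :=
    (hθ₀.fderiv_right (m := 0) (by simp)).continuousAt.eventually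
      (Units.isOpen.mem_nhds ⟨u₀, hu₀⟩)
  obtain ⟨O, hO, hOo, hxO⟩ := eventually_nhds_iff.1 ((hθ.and hunit_near).and hs)
  have hsource : (e.restr O).source = e.source ∩ O := e.restr_source' O hOo
  have hmem {x : E} (hx : x ∈ (e.restr O).source) : x ∈ O := (hsource.subset hx).2
  refine ⟨e.restr O, rfl, hsource.superset ⟨hθ₀.mem_toOpenPartialHomeomorph_source _ hne, hxO⟩,
    fun x hx ↦ (hO x (hmem hx)).2, fun x hx ↦ (hO x (hmem hx)).1.1.contDiffWithinAt, ?_⟩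
  intro y hy
  obtain ⟨⟨hsmooth, u, hu⟩, -⟩ := hO _ (hmem ((e.restr O).map_target hy))
  exact ((e.restr O).contDiffAt_symm hy (hderiv hsmooth hu) hsmooth).contDiffWithinAt

theorem exists_openPartialHomeomorph_fderiv_comp_eq {Y : Type*} [NormedAddCommGroup Y]
    [NormedSpace ℝ Y] {g : E → Y} {x₀ : E} (hg : ∀ᶠ x in 𝓝 x₀, ContDiffAt ℝ ∞ g x)
    (hinv : (fderiv ℝ g x₀).HasRightInverse) {s : Set E} (hs : s ∈ 𝓝 x₀) :
    ∃ e : OpenPartialHomeomorph E E, x₀ ∈ e.source ∧ e.source ⊆ s ∧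
      ContDiffOn ℝ ∞ e e.source ∧ ContDiffOn ℝ ∞ e.symm e.target ∧
      HasFDerivAt e (1 : E →L[ℝ] E) x₀ ∧ ∀ x, fderiv ℝ g x₀ (e x) = g x := by
  set D := fderiv ℝ g x₀
  obtain ⟨R, hR⟩ := hinv
  let θ : E → E := fun x ↦ x - R (D x) + R (g x)
  have hθ : ∀ᶠ x in 𝓝 x₀, ContDiffAt ℝ ∞ θ x := by
    filter_upwards [hg] with x hx
    exact (contDiffAt_id.sub (R.contDiff.comp D.contDiff).contDiffAt).add
      (R.contDiff.contDiffAt.comp x hx)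
  have hθ' : HasFDerivAt θ (1 : E →L[ℝ] E) x₀ := by
    have hgd : HasFDerivAt g D x₀ := (hg.self_of_nhds.differentiableAt (by simp)).hasFDerivAt
    refine (((hasFDerivAt_id (𝕜 := ℝ) x₀).sub (R ∘L D).hasFDerivAt).add
      (R.hasFDerivAt.comp x₀ hgd)).congr_fderiv ?_
    exact sub_add_cancel _ _
  obtain ⟨e, he, hx₀, hes, hsmooth, hsmooth'⟩ :=
    exists_openPartialHomeomorph_contDiffOn hθ (hθ'.fderiv ▸ isUnit_one) hs
  refine ⟨e, hx₀, hes, hsmooth, hsmooth', he ▸ hθ', fun x ↦ ?_⟩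
  simp only [he, θ, map_add, map_sub, hR (D x), hR (g x), sub_self, zero_add]

end InverseFunction

section SliceChart

variable {E : Type*} [NormedAddCommGroup E] [NormedSpace ℝ E]
  {P : Type*} [TopologicalSpace P] [ChartedSpace E P]
  {X Y : Type*} [NormedAddCommGroup X] [NormedSpace ℝ X] [NormedAddCommGroup Y] [NormedSpace ℝ Y]

theorem mvfderiv_comp_eq_fderiv_comp {g : X → Y} {f : P → X} {p : P}
    (hg : DifferentiableAt ℝ g (f p)) (hf : MDifferentiableAt 𝓘(ℝ, E) 𝓘(ℝ, X) f p) :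
    mvfderiv 𝓘(ℝ, E) (g ∘ f) p = fderiv ℝ g (f p) ∘L mvfderiv 𝓘(ℝ, E) f p := by
  rw [← mfderiv_eq_fderiv]
  exact mfderiv_comp p hg.mdifferentiableAt hf

theorem mvfderiv_congr {f g : P → X} {p : P} (h : f =ᶠ[𝓝 p] g) :
    mvfderiv 𝓘(ℝ, E) f p = mvfderiv 𝓘(ℝ, E) g p :=
  h.mfderiv_eq

theorem mvfderiv_clm_apply_of_eq_zero {Ψ : P → X →L[ℝ] Y} {f : P → X} {p : P}
    (hΨ : MDifferentiableAt 𝓘(ℝ, E) 𝓘(ℝ, X →L[ℝ] Y) Ψ p)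
    (hf : MDifferentiableAt 𝓘(ℝ, E) 𝓘(ℝ, X) f p) (hfp : f p = 0) :
    mvfderiv 𝓘(ℝ, E) (fun q ↦ Ψ q (f q)) p = Ψ p ∘L mvfderiv 𝓘(ℝ, E) f p := by
  have hΨf : MDifferentiableAt 𝓘(ℝ, E) 𝓘(ℝ, (X →L[ℝ] Y) × X) (fun q ↦ (Ψ q, f q)) p :=
    hΨ.prodMk_space hf
  have happly : HasFDerivAt (fun x : (X →L[ℝ] Y) × X ↦ x.1 x.2)
      (Ψ p ∘L ContinuousLinearMap.snd ℝ (X →L[ℝ] Y) X) (Ψ p, f p) := by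
    refine (isBoundedBilinearMap_apply.hasFDerivAt (𝕜 := ℝ) (Ψ p, f p)).congr_fderiv ?_
    ext x <;> simp [hfp]
  have hsnd : mvfderiv 𝓘(ℝ, E) f p = ContinuousLinearMap.snd ℝ (X →L[ℝ] Y) X ∘L
      mvfderiv 𝓘(ℝ, E) (fun q ↦ (Ψ q, f q)) p := by
    rw [← (ContinuousLinearMap.snd ℝ (X →L[ℝ] Y) X).fderiv (x := (Ψ p, f p))]
    exact mvfderiv_comp_eq_fderiv_comp (f := fun q ↦ (Ψ q, f q))
      (ContinuousLinearMap.snd ℝ (X →L[ℝ] Y) X).differentiableAt hΨf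
  rw [hsnd, ← ContinuousLinearMap.comp_assoc, ← happly.fderiv]
  exact mvfderiv_comp_eq_fderiv_comp (f := fun q ↦ (Ψ q, f q)) happly.differentiableAt hΨf

theorem trans_mem_maximalAtlas [IsManifold 𝓘(ℝ, E) ∞ P] {χ : OpenPartialHomeomorph P E}
    (hχ : χ ∈ IsManifold.maximalAtlas 𝓘(ℝ, E) ∞ P) {e : OpenPartialHomeomorph E E}
    (he : ContDiffOn ℝ ∞ e e.source) (he' : ContDiffOn ℝ ∞ e.symm e.target) :
    χ.trans e ∈ IsManifold.maximalAtlas 𝓘(ℝ, E) ∞ P := by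
  refine OpenPartialHomeomorph.mem_maximalAtlas_of_contMDiffOn _ ?_ ?_
  · rw [OpenPartialHomeomorph.coe_trans, OpenPartialHomeomorph.trans_source]
    exact he.contMDiffOn.comp ((contMDiffOn_of_mem_maximalAtlas hχ).mono
      Set.inter_subset_left) Set.inter_subset_right
  · rw [OpenPartialHomeomorph.coe_trans_symm, OpenPartialHomeomorph.trans_target]
    exact (contMDiffOn_symm_of_mem_maximalAtlas hχ).comp (he'.contMDiffOn.mono
      Set.inter_subset_left) Set.inter_subset_right

theorem mvfderiv_chart_bijective {φ : OpenPartialHomeomorph P E}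
    (hφ : φ ∈ IsManifold.maximalAtlas 𝓘(ℝ, E) ∞ P) {p : P} (hp : p ∈ φ.source) :
    Function.Bijective (mvfderiv 𝓘(ℝ, E) φ p) := by
  have hφd : φ.MDifferentiable 𝓘(ℝ, E) 𝓘(ℝ, E) :=
    ⟨(contMDiffOn_of_mem_maximalAtlas hφ).mdifferentiableOn (by simp),
      (contMDiffOn_symm_of_mem_maximalAtlas hφ).mdifferentiableOn (by simp)⟩
  exact hφd.mfderiv_bijective hp

theorem contDiffAt_comp_symm {f : P → X} {φ : OpenPartialHomeomorph P E}
    (hφ : φ ∈ IsManifold.maximalAtlas 𝓘(ℝ, E) ∞ P) {p : P} (hp : p ∈ φ.source)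
    (hf : ContMDiffAt 𝓘(ℝ, E) 𝓘(ℝ, X) ∞ f p) : ContDiffAt ℝ ∞ (f ∘ φ.symm) (φ p) :=
  (ContMDiffAt.comp_of_eq hf (contMDiffAt_symm_of_mem_maximalAtlas hφ (φ.map_source hp))
    (φ.left_inv hp)).contDiffAt

theorem eventually_contDiffAt_comp_symm {f : P → X} {φ : OpenPartialHomeomorph P E}
    (hφ : φ ∈ IsManifold.maximalAtlas 𝓘(ℝ, E) ∞ P) {p : P} (hp : p ∈ φ.source)
    (hf : ∀ᶠ q in 𝓝 p, ContMDiffAt 𝓘(ℝ, E) 𝓘(ℝ, X) ∞ f q) :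
    ∀ᶠ x in 𝓝 (φ p), ContDiffAt ℝ ∞ (f ∘ φ.symm) x := by
  filter_upwards [(φ.tendsto_symm hp).eventually hf,
    φ.open_target.mem_nhds (φ.map_source hp)] with x hfx hx
  simpa only [φ.right_inv hx] using contDiffAt_comp_symm hφ (φ.map_target hx) hfx

theorem mvfderiv_eq_fderiv_comp {f : P → X} {φ : OpenPartialHomeomorph P E}
    (hφ : φ ∈ IsManifold.maximalAtlas 𝓘(ℝ, E) ∞ P) {p : P} (hp : p ∈ φ.source)
    (hf : ContMDiffAt 𝓘(ℝ, E) 𝓘(ℝ, X) ∞ f p) :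
    mvfderiv 𝓘(ℝ, E) f p = fderiv ℝ (f ∘ φ.symm) (φ p) ∘L mvfderiv 𝓘(ℝ, E) φ p := by
  have hne : (∞ : WithTop ℕ∞) ≠ 0 := by simp
  rw [← mvfderiv_comp_eq_fderiv_comp ((contDiffAt_comp_symm hφ hp hf).differentiableAt hne)
    ((contMDiffAt_of_mem_maximalAtlas hφ hp).mdifferentiableAt hne)]
  refine mvfderiv_congr ?_
  filter_upwards [φ.open_source.mem_nhds hp] with q hq
  exact congrArg f (φ.left_inv hq).symm

theorem exists_isSliceChart_of_submersion [IsManifold 𝓘(ℝ, E) ∞ P] [FiniteDimensional ℝ E]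
    {S : Set P} {p : P} {G : P → Y} (hG : ∀ᶠ q in 𝓝 p, ContMDiffAt 𝓘(ℝ, E) 𝓘(ℝ, Y) ∞ G q)
    (hS : ∀ᶠ q in 𝓝 p, (q ∈ S ↔ G q = 0))
    (hsurj : Function.Surjective (mvfderiv 𝓘(ℝ, E) G p)) :
    ∃ (φ : OpenPartialHomeomorph P E) (F : Submodule ℝ E), IsSliceChart S p φ F ∧
      Module.finrank ℝ F + Module.finrank ℝ Y = Module.finrank ℝ E ∧
      F.comap (mvfderiv 𝓘(ℝ, E) φ p).toLinearMap =
        LinearMap.ker (mvfderiv 𝓘(ℝ, E) G p).toLinearMap := by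
  have hp := mem_chart_source E p
  have hχ := IsManifold.chart_mem_maximalAtlas (I := 𝓘(ℝ, E)) (n := ∞) p
  set χ := chartAt E p
  set D := fderiv ℝ (G ∘ χ.symm) (χ p)
  have hdG : mvfderiv 𝓘(ℝ, E) G p = D ∘L mvfderiv 𝓘(ℝ, E) χ p :=
    mvfderiv_eq_fderiv_comp hχ hp hG.self_of_nhds
  have hDsurj : Function.Surjective D := by
    rw [hdG, ContinuousLinearMap.coe_comp] at hsurj
    exact hsurj.of_comp
  have : FiniteDimensional ℝ Y := Module.Finite.of_surjective D.toLinearMap hDsurj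
  obtain ⟨e, hxe, hes, he, he', hderiv, hcomp⟩ := exists_openPartialHomeomorph_fderiv_comp_eq
    (eventually_contDiffAt_comp_symm hχ hp hG)
    (.of_surjective_of_finiteDimensional hDsurj) ((χ.tendsto_symm hp).eventually hS)
  refine ⟨χ.trans e, LinearMap.ker D.toLinearMap, ⟨trans_mem_maximalAtlas hχ he he', ?_, ?_⟩, ?_,
    ?_⟩
  · exact (χ.trans_source e).superset ⟨hp, hxe⟩
  · intro q hq
    obtain ⟨hqχ, hqe⟩ := (χ.trans_source e).subset hq
    have hqS : χ.symm (χ q) ∈ S ↔ G (χ.symm (χ q)) = 0 := hes hqe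
    rw [χ.left_inv hqχ] at hqS
    rw [hqS, LinearMap.mem_ker, OpenPartialHomeomorph.coe_trans, Function.comp_apply,
      ContinuousLinearMap.coe_coe, hcomp, Function.comp_apply, χ.left_inv hqχ]
  · have hrank := D.toLinearMap.finrank_range_add_finrank_ker
    rw [LinearMap.range_eq_top.2 hDsurj, finrank_top] at hrank
    lia
  · rw [OpenPartialHomeomorph.coe_trans, mvfderiv_comp_eq_fderiv_comp hderiv.differentiableAt
      ((contMDiffAt_of_mem_maximalAtlas hχ hp).mdifferentiableAt (by simp)), hderiv.fderiv, hdG]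
    rfl

theorem apply_eq_zero_iff_of_norm_sub_lt_one {a b : X →L[ℝ] X} (hb : IsIdempotentElem b)
    (hab : ‖b - a‖ < 1) (x : X) : a (b x) = 0 ↔ b x = 0 := by
  refine ⟨fun h ↦ ?_, fun h ↦ by rw [h, map_zero]⟩
  have hbx : (b - a) (b x) = b x := by
    rw [sub_apply, h, sub_zero]
    exact DFunLike.congr_fun hb x
  by_contra hne
  refine lt_irrefl ‖b x‖ ?_
  calc ‖b x‖ = ‖(b - a) (b x)‖ := by rw [hbx]
    _ ≤ ‖b - a‖ * ‖b x‖ := (b - a).le_opNorm _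
    _ < 1 * ‖b x‖ := by gcongr
    _ = ‖b x‖ := one_mul _

theorem exists_isSliceChart_setOf_idempotent_apply_eq_zero [IsManifold 𝓘(ℝ, E) ∞ P]
    [FiniteDimensional ℝ E] {f : P → X} {Ψ : P → X →L[ℝ] X} {p : P}
    (hf : ∀ᶠ q in 𝓝 p, ContMDiffAt 𝓘(ℝ, E) 𝓘(ℝ, X) ∞ f q) (hfp : f p = 0)
    (hΨ : ∀ᶠ q in 𝓝 p, ContMDiffAt 𝓘(ℝ, E) 𝓘(ℝ, X →L[ℝ] X) ∞ Ψ q ∧ IsIdempotentElem (Ψ q))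
    (hrange : (Ψ p).range ≤ (Ψ p ∘L mvfderiv 𝓘(ℝ, E) f p).range) :
    ∃ (φ : OpenPartialHomeomorph P E) (F : Submodule ℝ E),
      IsSliceChart {q | Ψ q (f q) = 0} p φ F ∧
      Module.finrank ℝ F + Module.finrank ℝ (Ψ p).range = Module.finrank ℝ E ∧
      F.comap (mvfderiv 𝓘(ℝ, E) φ p).toLinearMap =
        LinearMap.ker ((Ψ p).toLinearMap ∘ₗ (mvfderiv 𝓘(ℝ, E) f p).toLinearMap) := by
  let G (q : P) : (Ψ p).range := (Ψ p).rangeRestrict (Ψ q (f q))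
  have hΨf : ∀ᶠ q in 𝓝 p, ContMDiffAt 𝓘(ℝ, E) 𝓘(ℝ, X) ∞ (fun q ↦ Ψ q (f q)) q := by
    filter_upwards [hf, hΨ] with q hfq hΨq
    exact hΨq.1.clm_apply hfq
  have hG : ∀ᶠ q in 𝓝 p, ContMDiffAt 𝓘(ℝ, E) 𝓘(ℝ, (Ψ p).range) ∞ G q :=
    hΨf.mono fun q hq ↦ (Ψ p).rangeRestrict.contDiff.contMDiff.contMDiffAt.comp q hq
  have hzero : ∀ᶠ q in 𝓝 p, (Ψ q (f q) = 0 ↔ G q = 0) := by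
    have hnorm : ∀ᶠ q in 𝓝 p, ‖Ψ q - Ψ p‖ < 1 := by
      simpa only [dist_eq_norm] using!
        hΨ.self_of_nhds.1.continuousAt.eventually (Metric.ball_mem_nhds _ one_pos)
    filter_upwards [hΨ, hnorm] with q hΨq hq
    rw [← apply_eq_zero_iff_of_norm_sub_lt_one hΨq.2 hq]
    exact (Submodule.mk_eq_zero (Ψ p).range _).symm
  have hderiv (v : TangentSpace 𝓘(ℝ, E) p) :
      (mvfderiv 𝓘(ℝ, E) G p v : X) = Ψ p (mvfderiv 𝓘(ℝ, E) f p v) := by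
    have hne : (∞ : WithTop ℕ∞) ≠ 0 := by simp
    have hcomp : mvfderiv 𝓘(ℝ, E) G p = (Ψ p).rangeRestrict ∘L Ψ p ∘L mvfderiv 𝓘(ℝ, E) f p := by
      rw [← mvfderiv_clm_apply_of_eq_zero (hΨ.self_of_nhds.1.mdifferentiableAt hne)
        (hf.self_of_nhds.mdifferentiableAt hne) hfp,
        ← (Ψ p).rangeRestrict.fderiv (x := Ψ p (f p))]
      exact mvfderiv_comp_eq_fderiv_comp (Ψ p).rangeRestrict.differentiableAt
        (hΨf.self_of_nhds.mdifferentiableAt hne)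
    rw [hcomp]
    exact DFunLike.congr_fun hΨ.self_of_nhds.2 (mvfderiv 𝓘(ℝ, E) f p v)
  have hsurj : Function.Surjective (mvfderiv 𝓘(ℝ, E) G p) := fun y ↦ by
    obtain ⟨v, hv⟩ := hrange y.2
    exact ⟨v, Subtype.ext ((hderiv v).trans hv)⟩
  obtain ⟨φ, F, hφ, hdim, hF⟩ := exists_isSliceChart_of_submersion hG hzero hsurj
  refine ⟨φ, F, hφ, hdim, hF.trans (Submodule.ext fun v ↦ ?_)⟩
  rw [LinearMap.mem_ker, LinearMap.mem_ker, LinearMap.comp_apply]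
  exact Subtype.ext_iff.trans (Eq.congr_left (hderiv v))

end SliceChart

/-! ### Gluing -/

section Gluing

variable {E : Type*} [NormedAddCommGroup E] [NormedSpace ℝ E]
  {P : Type*} [TopologicalSpace P] [ChartedSpace E P]
  {Y : Type*} [NormedAddCommGroup Y] [NormedSpace ℝ Y]

theorem contMDiffOn_extend {O : TopologicalSpace.Opens P} {g : O → Y}
    (hg : ContMDiff 𝓘(ℝ, E) 𝓘(ℝ, Y) ∞ g) (g₀ : P → Y) :
    ContMDiffOn 𝓘(ℝ, E) 𝓘(ℝ, Y) ∞ (Function.extend Subtype.val g g₀) O := by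
  intro q hq
  refine ContMDiffAt.contMDiffWithinAt (contMDiffAt_subtype_iff (x := ⟨q, hq⟩).1 ?_)
  simpa only [Subtype.val_injective.extend_apply] using! hg.contMDiffAt

variable [FiniteDimensional ℝ E] [T2Space P] [SecondCountableTopology P]

theorem exists_contMDiffOn_forall_mem_convex [IsManifold 𝓘(ℝ, E) ∞ P] {C : Set P}
    {t : P → Set Y} (ht : ∀ p, Convex ℝ (t p))
    (hloc : ∀ p ∈ C, ∃ g : P → Y, ∀ᶠ q in 𝓝 p, ContMDiffAt 𝓘(ℝ, E) 𝓘(ℝ, Y) ∞ g q ∧ g q ∈ t q) :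
    ∃ (g : P → Y) (O : Set P), IsOpen O ∧ C ⊆ O ∧ ContMDiffOn 𝓘(ℝ, E) 𝓘(ℝ, Y) ∞ g O ∧
      ∀ p ∈ O, g p ∈ t p := by
  choose! g hg using hloc
  let U (p : P) : Set P := interior {q | ContMDiffAt 𝓘(ℝ, E) 𝓘(ℝ, Y) ∞ (g p) q ∧ g p q ∈ t q}
  let O : TopologicalSpace.Opens P := ⟨⋃ p ∈ C, U p, isOpen_biUnion fun _ _ ↦ isOpen_interior⟩
  have : LocallyCompactSpace P := ChartedSpace.locallyCompactSpace E P
  have : LocallyCompactSpace O := O.isOpen.locallyCompactSpace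
  obtain ⟨h, hh⟩ := exists_contMDiffMap_forall_mem_convex_of_local (M := O) 𝓘(ℝ, E)
    (n := ⊤) (t := fun q ↦ t q) (fun q ↦ ht q) fun q ↦ by
      obtain ⟨p, -, hq⟩ := Set.mem_iUnion₂.1 q.2
      refine ⟨_, (isOpen_interior.preimage continuous_subtype_val).mem_nhds hq, fun q ↦ g p q,
        fun x hx ↦ ?_, fun x hx ↦ (interior_subset hx).2⟩
      exact (contMDiffAt_subtype_iff.2 (interior_subset hx).1).contMDiffWithinAt
  refine ⟨Function.extend Subtype.val h 0, O, O.isOpen, fun p hp ↦ ?_,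
    contMDiffOn_extend h.contMDiff 0, fun p hp ↦ ?_⟩
  · exact Set.mem_iUnion₂.2 ⟨p, hp, mem_interior_iff_mem_nhds.2 (hg p hp)⟩
  · exact (Subtype.val_injective.extend_apply h 0 ⟨p, hp⟩).symm ▸ hh ⟨p, hp⟩

end Gluing

section DefiningMap

variable {E : Type*} [NormedAddCommGroup E] [NormedSpace ℝ E]
  {P : Type*} [TopologicalSpace P] [ChartedSpace E P]
  {X : Type*} [NormedAddCommGroup X] [NormedSpace ℝ X]
  {Y : Type*} [NormedAddCommGroup Y] [NormedSpace ℝ Y]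

variable (E) in
/-- A smooth map `f` on the open set `O` with values in a Banach space cuts out the submanifold
`S` to first order: along `S` it vanishes, and the kernel of its derivative is the tangent space.
Unlike a submersion with zero set `S`, such a map exists near every embedded submanifold. -/
structure IsDefiningMapOn (f : P → X) (S O : Set P) : Prop where
  isOpen : IsOpen O
  contMDiffOn : ContMDiffOn 𝓘(ℝ, E) 𝓘(ℝ, X) ∞ f O
  apply_eq_zero : ∀ p ∈ O, p ∈ S → f p = 0
  ker_mvfderiv : ∀ p ∈ O, p ∈ S →
    LinearMap.ker (mvfderiv 𝓘(ℝ, E) f p).toLinearMap = submanifoldTangent E S p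

theorem IsDefiningMapOn.eventually_contMDiffAt {f : P → X} {S O : Set P}
    (hf : IsDefiningMapOn E f S O) {p : P} (hp : p ∈ O) :
    ∀ᶠ q in 𝓝 p, ContMDiffAt 𝓘(ℝ, E) 𝓘(ℝ, X) ∞ f q :=
  (hf.isOpen.eventually_mem hp).mono fun _ hq ↦
    hf.contMDiffOn.contMDiffAt (hf.isOpen.mem_nhds hq)

theorem IsSliceChart.of_mem_source {S : Set P} {p q : P} {φ : OpenPartialHomeomorph P E}
    {F : Submodule ℝ E} (hφ : IsSliceChart S p φ F) (hq : q ∈ φ.source) : IsSliceChart S q φ F :=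
  ⟨hφ.mem_maximalAtlas, hq, hφ.mem_iff⟩

theorem IsSliceChart.exists_isDefiningMapOn [IsManifold 𝓘(ℝ, E) ∞ P] [FiniteDimensional ℝ E]
    {S : Set P} {p : P} {φ : OpenPartialHomeomorph P E} {F : Submodule ℝ E}
    (hφ : IsSliceChart S p φ F) : ∃ f : P → E, IsDefiningMapOn E f S φ.source := by
  obtain ⟨G, hG⟩ := F.exists_isCompl
  let ν : E →L[ℝ] E := (Submodule.projection G F hG.symm).toContinuousLinearMap
  have hν (x : E) : ν x = 0 ↔ x ∈ F :=
    SetLike.ext_iff.1 (Submodule.ker_projection hG.symm) x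
  refine ⟨ν ∘ φ, φ.open_source,
    ν.contDiff.contMDiff.comp_contMDiffOn (contMDiffOn_of_mem_maximalAtlas hφ.mem_maximalAtlas),
    fun q hq hqS ↦ (hν _).2 ((hφ.mem_iff q hq).1 hqS), fun q hq hqS ↦ ?_⟩
  rw [submanifoldTangent_eq hqS (hφ.of_mem_source hq),
    mvfderiv_comp_eq_fderiv_comp ν.differentiableAt ((contMDiffAt_of_mem_maximalAtlas
      hφ.mem_maximalAtlas hq).mdifferentiableAt (by simp)), ν.fderiv]
  exact Submodule.ext fun v ↦ hν _

theorem mvfderiv_smul_of_eq_zero {ρ : P → ℝ} {g : P → Y} {p : P}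
    (hρ : MDifferentiableAt 𝓘(ℝ, E) 𝓘(ℝ, ℝ) ρ p) (hg : MDifferentiableAt 𝓘(ℝ, E) 𝓘(ℝ, Y) g p)
    (hgp : g p = 0) : mvfderiv 𝓘(ℝ, E) (ρ • g) p = ρ p • mvfderiv 𝓘(ℝ, E) g p := by
  rw [mvfderiv_smul hρ hg, hgp]
  ext v
  simp

theorem finsum_smul_lp_single_apply {M ι : Type*} [TopologicalSpace M] [DecidableEq ι]
    {ρ : ι → M → ℝ} (hρ : LocallyFinite fun i ↦ Function.support (ρ i)) (y : ι → Y) (x : M)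
    (j : ι) :
    (∑ᶠ i, ρ i x • lp.single (E := fun _ ↦ Y) ⊤ i (y i) : lp (fun _ : ι ↦ Y) ⊤) j =
      ρ j x • y j := by
  have hfin : (Function.support fun i ↦ ρ i x • lp.single (E := fun _ ↦ Y) ⊤ i (y i)).Finite :=
    (hρ.point_finite x).subset fun i hi ↦ left_ne_zero_of_smul hi
  have hmap := (lp.evalCLM ℝ (fun _ : ι ↦ Y) ⊤ j).toLinearMap.toAddMonoidHom.map_finsum hfin
  refine hmap.trans ((finsum_eq_single _ j fun i hij ↦ ?_).trans ?_)
  · exact (congrArg (ρ i x • ·) (lp.single_apply_ne (E := fun _ ↦ Y) ⊤ i (y i) hij.symm)).trans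
      (smul_zero _)
  · exact congrArg (ρ j x • ·) (lp.single_apply_self (E := fun _ ↦ Y) ⊤ j (y j))

section LpGlue

variable {ι : Type*} [DecidableEq ι] {O : TopologicalSpace.Opens P}

/-- The map with coordinates `ρ i • g i`, for a partition of unity `ρ` on the open set `O`: it
collects local maps `g i` into a single one without mixing them. -/
noncomputable def lpGlue (ρ : SmoothPartitionOfUnity ι 𝓘(ℝ, E) O) (g : ι → P → Y) :
    P → lp (fun _ : ι ↦ Y) ⊤ :=
  Function.extend Subtype.val
    (fun x : O ↦ ∑ᶠ i, ρ i x • lp.single (E := fun _ ↦ Y) ⊤ i (g i x)) 0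

variable {ρ : SmoothPartitionOfUnity ι 𝓘(ℝ, E) O} {g : ι → P → Y} {U : ι → Set P}

theorem lpGlue_apply {p : P} (hp : p ∈ O) (i : ι) : lpGlue ρ g p i = ρ i ⟨p, hp⟩ • g i p := by
  rw [lpGlue, Subtype.val_injective.extend_apply _ _ (⟨p, hp⟩ : O)]
  exact finsum_smul_lp_single_apply ρ.locallyFinite (fun i ↦ g i p) ⟨p, hp⟩ i

theorem contMDiffOn_lpGlue (hρ : ρ.IsSubordinate fun i ↦ Subtype.val ⁻¹' U i)
    (hU : ∀ i, IsOpen (U i)) (hg : ∀ i, ContMDiffOn 𝓘(ℝ, E) 𝓘(ℝ, Y) ∞ (g i) (U i)) :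
    ContMDiffOn 𝓘(ℝ, E) 𝓘(ℝ, lp (fun _ : ι ↦ Y) ⊤) ∞ (lpGlue ρ g) O := by
  refine contMDiffOn_extend (hρ.contMDiff_finsum_smul
    (fun i ↦ (hU i).preimage continuous_subtype_val) fun i x hx ↦ ?_) 0
  have hgx : ContMDiffAt 𝓘(ℝ, E) 𝓘(ℝ, Y) ∞ (fun x : O ↦ g i x) x :=
    contMDiffAt_subtype_iff.2 ((hg i).contMDiffAt ((hU i).mem_nhds hx))
  exact ((lp.singleContinuousLinearMap ℝ (fun _ ↦ Y) ⊤ i).contDiff.contMDiff.contMDiffAt.comp x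
    hgx).contMDiffWithinAt

theorem mvfderiv_lpGlue_apply (hρ : ρ.IsSubordinate fun i ↦ Subtype.val ⁻¹' U i)
    (hU : ∀ i, IsOpen (U i)) (hg : ∀ i, ContMDiffOn 𝓘(ℝ, E) 𝓘(ℝ, Y) ∞ (g i) (U i))
    {p : P} (hp : p ∈ O) {i : ι} (hgp : p ∈ U i → g i p = 0) (v : TangentSpace 𝓘(ℝ, E) p) :
    (mvfderiv 𝓘(ℝ, E) (lpGlue ρ g) p v : lp (fun _ : ι ↦ Y) ⊤) i =
      ρ i ⟨p, hp⟩ • mvfderiv 𝓘(ℝ, E) (g i) p v := by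
  have hne : (∞ : WithTop ℕ∞) ≠ 0 := by simp
  let ρ' : P → ℝ := Function.extend Subtype.val (ρ i) 0
  have hρ'_apply (x : O) : ρ' x = ρ i x := Subtype.val_injective.extend_apply _ _ x
  have hcoord : mvfderiv 𝓘(ℝ, E) (ρ' • g i) p =
      lp.evalCLM ℝ (fun _ : ι ↦ Y) ⊤ i ∘L mvfderiv 𝓘(ℝ, E) (lpGlue ρ g) p := by
    rw [← (lp.evalCLM ℝ (fun _ : ι ↦ Y) ⊤ i).fderiv (x := lpGlue ρ g p),
      ← mvfderiv_comp_eq_fderiv_comp (lp.evalCLM ℝ (fun _ : ι ↦ Y) ⊤ i).differentiableAt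
      (((contMDiffOn_lpGlue hρ hU hg).contMDiffAt (O.isOpen.mem_nhds hp)).mdifferentiableAt hne)]
    refine mvfderiv_congr ?_
    filter_upwards [O.isOpen.mem_nhds hp] with q hq
    exact (congrArg (· • g i q) (hρ'_apply ⟨q, hq⟩)).trans (lpGlue_apply hq i).symm
  refine (DFunLike.congr_fun hcoord v).symm.trans ?_
  rw [← hρ'_apply]
  by_cases hpU : p ∈ U i
  · have hρ' := (contMDiffOn_extend (ρ i).contMDiff 0).contMDiffAt (O.isOpen.mem_nhds hp)
    rw [mvfderiv_smul_of_eq_zero (hρ'.mdifferentiableAt hne)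
      (((hg i).contMDiffAt ((hU i).mem_nhds hpU)).mdifferentiableAt hne) (hgp hpU)]
    rfl
  · have hρ_zero : ρ i =ᶠ[𝓝 ⟨p, hp⟩] 0 :=
      notMem_tsupport_iff_eventuallyEq.1 fun hmem ↦ hpU (hρ i hmem)
    have hρ'_zero : ∀ᶠ q in 𝓝 p, ρ' q = 0 := by
      rw [← O.isOpenEmbedding'.map_nhds_eq ⟨p, hp⟩, eventually_map]
      exact hρ_zero.mono fun x hx ↦ (hρ'_apply x).trans hx
    have hsmul_zero : ρ' • g i =ᶠ[𝓝 p] fun _ ↦ 0 := hρ'_zero.mono fun q hq ↦ by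
      rw [Pi.smul_apply', hq, zero_smul]
    rw [mvfderiv_congr hsmul_zero, mvfderiv_const, hρ'_zero.self_of_nhds, zero_smul]
    rfl

end LpGlue

variable [FiniteDimensional ℝ E] [T2Space P] [SecondCountableTopology P]
  [IsManifold 𝓘(ℝ, E) ∞ P]

theorem exists_isDefiningMapOn_iUnion {ι : Type*} {g : ι → P → Y} {S : Set P} {U : ι → Set P}
    (hg : ∀ i, IsDefiningMapOn E (g i) S (U i)) :
    ∃ f : P → lp (fun _ : ι ↦ Y) ⊤, IsDefiningMapOn E f S (⋃ i, U i) := by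
  classical
  have hU (i : ι) : IsOpen (U i) := (hg i).isOpen
  let O : TopologicalSpace.Opens P := ⟨⋃ i, U i, isOpen_iUnion hU⟩
  have : LocallyCompactSpace P := ChartedSpace.locallyCompactSpace E P
  have : LocallyCompactSpace O := O.isOpen.locallyCompactSpace
  obtain ⟨ρ, hρ⟩ := SmoothPartitionOfUnity.exists_isSubordinate 𝓘(ℝ, E) (M := O) isClosed_univ
    (fun i ↦ Subtype.val ⁻¹' U i) (fun i ↦ (hU i).preimage continuous_subtype_val)
    fun x _ ↦ Set.preimage_iUnion.subset x.2
  have hmem {p : P} (hp : p ∈ O) {i : ι} (hi : ρ i ⟨p, hp⟩ ≠ 0) : p ∈ U i :=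
    hρ i (subset_tsupport _ hi)
  refine ⟨lpGlue ρ g, O.isOpen, contMDiffOn_lpGlue hρ hU fun i ↦ (hg i).contMDiffOn,
    fun p hp hpS ↦ lp.ext (funext fun i ↦ ?_), fun p hp hpS ↦ Submodule.ext fun v ↦ ?_⟩
  · rw [lpGlue_apply hp]
    exact smul_eq_zero.2 (or_iff_not_imp_left.2 fun hi ↦
      (hg i).apply_eq_zero p (hmem hp hi) hpS)
  · have hcoord (i : ι) := mvfderiv_lpGlue_apply hρ hU (fun i ↦ (hg i).contMDiffOn) hp
      (i := i) (fun hpU ↦ (hg i).apply_eq_zero p hpU hpS) v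
    have hker {i : ι} (hi : ρ i ⟨p, hp⟩ ≠ 0) :
        v ∈ submanifoldTangent E S p ↔ mvfderiv 𝓘(ℝ, E) (g i) p v = 0 := by
      rw [← (hg i).ker_mvfderiv p (hmem hp hi) hpS]
      rfl
    refine ⟨fun hv ↦ ?_, fun hv ↦ lp.ext (funext fun i ↦ (hcoord i).trans ?_)⟩
    · obtain ⟨i, hi⟩ := ρ.exists_pos_of_mem (Set.mem_univ ⟨p, hp⟩)
      have hzero : (mvfderiv 𝓘(ℝ, E) (lpGlue ρ g) p v : lp (fun _ : ι ↦ Y) ⊤) i = 0 :=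
        congrArg (fun x : lp (fun _ : ι ↦ Y) ⊤ ↦ x i) hv
      exact (hker hi.ne').2 ((smul_eq_zero.1 ((hcoord i).symm.trans hzero)).resolve_left hi.ne')
    · exact smul_eq_zero.2 (or_iff_not_imp_left.2 fun hi ↦ (hker hi).1 hv)

theorem IsEmbeddedSubmanifold.exists_isDefiningMapOn {S : Set P} {k : ℕ}
    (hS : IsEmbeddedSubmanifold E S k) :
    ∃ (f : P → lp (fun _ : S ↦ E) ⊤) (O : Set P), S ⊆ O ∧ IsDefiningMapOn E f S O := by
  choose φ F hφ _ using hS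
  choose g hg using fun p : S ↦ (hφ p p.2).exists_isDefiningMapOn
  obtain ⟨f, hf⟩ := exists_isDefiningMapOn_iUnion hg
  exact ⟨f, _, fun p hp ↦ Set.mem_iUnion.2 ⟨⟨p, hp⟩, (hφ p hp).mem_source⟩, hf⟩

end DefiningMap

/-! ### Smoothness of the sharp map -/

section SmoothSharp

variable {E : Type*} [NormedAddCommGroup E] [NormedSpace ℝ E]
  {P : Type*} [TopologicalSpace P] [ChartedSpace E P]
  {X : Type*} [NormedAddCommGroup X] [NormedSpace ℝ X]

theorem eventually_contMDiffAt_fderiv_comp_symm {φ : OpenPartialHomeomorph P E}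
    (hφ : φ ∈ IsManifold.maximalAtlas 𝓘(ℝ, E) ∞ P) {g : P → X} {p : P} (hp : p ∈ φ.source)
    (hg : ∀ᶠ q in 𝓝 p, ContMDiffAt 𝓘(ℝ, E) 𝓘(ℝ, X) ∞ g q) :
    ∀ᶠ q in 𝓝 p,
      ContMDiffAt 𝓘(ℝ, E) 𝓘(ℝ, E →L[ℝ] X) ∞ (fun q ↦ fderiv ℝ (g ∘ φ.symm) (φ q)) q := by
  have hsmooth := (φ.continuousAt hp).eventually (eventually_contDiffAt_comp_symm hφ hp hg)
  filter_upwards [hsmooth, φ.open_source.mem_nhds hp] with q hgq hq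
  exact (hgq.fderiv_right (m := ∞) le_rfl).contMDiffAt.comp q
    (contMDiffAt_of_mem_maximalAtlas hφ hq)

theorem exists_forall_linearIndependent_mvfderiv [FiniteDimensional ℝ E]
    {φ : OpenPartialHomeomorph P E} (hφ : φ ∈ IsManifold.maximalAtlas 𝓘(ℝ, E) ∞ P)
    (F : Submodule ℝ E) : ∃ (n : ℕ) (η : Fin n → P → ℝ),
      (∀ i, ContMDiffOn 𝓘(ℝ, E) 𝓘(ℝ, ℝ) ∞ (η i) φ.source) ∧ ∀ q ∈ φ.source,
        LinearIndependent ℝ (fun i ↦ (mvfderiv 𝓘(ℝ, E) (η i) q).toLinearMap) ∧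
        (F.comap (mvfderiv 𝓘(ℝ, E) φ q).toLinearMap).dualAnnihilator =
          Submodule.span ℝ (Set.range fun i ↦ (mvfderiv 𝓘(ℝ, E) (η i) q).toLinearMap) := by
  obtain ⟨ξ, -, hspan, hli⟩ :=
    Submodule.exists_fun_fin_finrank_span_eq ℝ (F.dualAnnihilator : Set (Module.Dual ℝ E))
  replace hspan := hspan.trans (Submodule.span_eq _)
  refine ⟨_, fun i ↦ (ξ i).toContinuousLinearMap ∘ φ, fun i ↦
    (ξ i).toContinuousLinearMap.contDiff.contMDiff.comp_contMDiffOn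
      (contMDiffOn_of_mem_maximalAtlas hφ), fun q hq ↦ ?_⟩
  set A := (mvfderiv 𝓘(ℝ, E) φ q).toLinearMap
  have hη : (fun i ↦ (mvfderiv 𝓘(ℝ, E) ((ξ i).toContinuousLinearMap ∘ φ) q).toLinearMap) =
      A.dualMap ∘ ξ := funext fun i ↦ by
    rw [mvfderiv_comp_eq_fderiv_comp (ξ i).toContinuousLinearMap.differentiableAt
      ((contMDiffAt_of_mem_maximalAtlas hφ hq).mdifferentiableAt (by simp)),
      ContinuousLinearMap.fderiv]
    rfl
  rw [hη]
  refine ⟨hli.map' _ (LinearMap.ker_eq_bot.2 (LinearMap.dualMap_injective_of_surjective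
    (mvfderiv_chart_bijective hφ hq).surjective)), ?_⟩
  rw [Set.range_comp, ← Submodule.map_span, hspan, dualAnnihilator_comap_eq_map_dualMap]

variable [IsManifold 𝓘(ℝ, E) ∞ P]

theorem mvfderiv_apply_eq_sum_chartCovector {ι : Type*} [Fintype ι] (b : Module.Basis ι ℝ E)
    {g : P → X} {p q : P} (hq : q ∈ (chartAt E p).source)
    (hg : ContMDiffAt 𝓘(ℝ, E) 𝓘(ℝ, X) ∞ g q) (v : TangentSpace 𝓘(ℝ, E) q) :
    mvfderiv 𝓘(ℝ, E) g q v = ∑ i, chartCovector E p (b.coord i) q v •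
      fderiv ℝ (g ∘ (chartAt E p).symm) (chartAt E p q) (b i) := by
  rw [mvfderiv_eq_fderiv_comp (IsManifold.chart_mem_maximalAtlas p) hq hg,
    ContinuousLinearMap.comp_apply]
  conv_lhs => rw [← b.sum_repr (mvfderiv 𝓘(ℝ, E) (chartAt E p) q v)]
  simp only [map_sum, map_smul]
  rfl

namespace BivectorField

variable [FiniteDimensional ℝ E] (B : BivectorField E P)

theorem mvfderiv_sharp_mvfderiv_eq_sum {ι : Type*} [Fintype ι] (b : Module.Basis ι ℝ E)
    {f : P → ℝ} {g : P → X} {p q : P} (hq : q ∈ (chartAt E p).source)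
    (hf : ContMDiffAt 𝓘(ℝ, E) 𝓘(ℝ, ℝ) ∞ f q) (hg : ContMDiffAt 𝓘(ℝ, E) 𝓘(ℝ, X) ∞ g q) :
    mvfderiv 𝓘(ℝ, E) g q (B.sharp q (mvfderiv 𝓘(ℝ, E) f q).toLinearMap) =
      ∑ i, ∑ j, (fderiv ℝ (f ∘ (chartAt E p).symm) (chartAt E p q) (b j) *
        B.toFun q (chartCovector E p (b.coord j) q) (chartCovector E p (b.coord i) q)) •
        fderiv ℝ (g ∘ (chartAt E p).symm) (chartAt E p q) (b i) := by
  have hdf : (mvfderiv 𝓘(ℝ, E) f q).toLinearMap = ∑ j,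
      fderiv ℝ (f ∘ (chartAt E p).symm) (chartAt E p q) (b j) •
        chartCovector E p (b.coord j) q := by
    refine LinearMap.ext fun v ↦ ?_
    rw [LinearMap.sum_apply]
    refine (mvfderiv_apply_eq_sum_chartCovector b hq hf v).trans
      (Finset.sum_congr rfl fun j _ ↦ mul_comm _ _)
  rw [mvfderiv_apply_eq_sum_chartCovector b hq hg, hdf]
  refine Finset.sum_congr rfl fun i _ ↦ ?_
  rw [← Finset.sum_smul, sharp, PoissonLinear.apply_sharp]
  simp only [map_sum, map_smul, LinearMap.sum_apply, LinearMap.smul_apply, smul_eq_mul]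

theorem eventually_contMDiffAt_mvfderiv_sharp_mvfderiv {f : P → ℝ} {g : P → X} {p : P}
    (hf : ∀ᶠ q in 𝓝 p, ContMDiffAt 𝓘(ℝ, E) 𝓘(ℝ, ℝ) ∞ f q)
    (hg : ∀ᶠ q in 𝓝 p, ContMDiffAt 𝓘(ℝ, E) 𝓘(ℝ, X) ∞ g q) :
    ∀ᶠ q in 𝓝 p, ContMDiffAt 𝓘(ℝ, E) 𝓘(ℝ, X) ∞
      (fun q ↦ mvfderiv 𝓘(ℝ, E) g q (B.sharp q (mvfderiv 𝓘(ℝ, E) f q).toLinearMap)) q := by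
  have hp := mem_chart_source E p
  have hχ := IsManifold.chart_mem_maximalAtlas (I := 𝓘(ℝ, E)) (n := ∞) p
  have hsource := (chartAt E p).open_source.eventually_mem hp
  let b := Module.finBasis ℝ E
  filter_upwards [hsource.eventually_nhds, hf.eventually_nhds, hg.eventually_nhds,
    eventually_contMDiffAt_fderiv_comp_symm hχ hp hf,
    eventually_contMDiffAt_fderiv_comp_symm hχ hp hg] with q hq hfq hgq hdf hdg
  have hsum := (hq.and (hfq.and hgq)).mono fun q' h ↦
    B.mvfderiv_sharp_mvfderiv_eq_sum b h.1 h.2.1 h.2.2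
  refine ContMDiffAt.congr_of_eventuallyEq ?_ hsum
  refine contMDiffAt_finsetSum fun i _ ↦ contMDiffAt_finsetSum fun j _ ↦ ?_
  exact ((hdf.clm_apply contMDiffAt_const).mul ((B.contMDiffOn p _ _).contMDiffAt
    hq)).smul (hdg.clm_apply contMDiffAt_const)

theorem eventually_isCosymplectic_comap_mvfderiv {φ : OpenPartialHomeomorph P E}
    (hφ : φ ∈ IsManifold.maximalAtlas 𝓘(ℝ, E) ∞ P) {F : Submodule ℝ E} {p : P}
    (hp : p ∈ φ.source) (h : PoissonLinear.IsCosymplectic (B.sharp p)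
      (F.comap (mvfderiv 𝓘(ℝ, E) φ p).toLinearMap)) :
    ∀ᶠ q in 𝓝 p, PoissonLinear.IsCosymplectic (B.sharp q)
      (F.comap (mvfderiv 𝓘(ℝ, E) φ q).toLinearMap) := by
  obtain ⟨n, η, hη, hframe⟩ := exists_forall_linearIndependent_mvfderiv hφ F
  have hsource := φ.open_source.eventually_mem hp
  have hη_near (i) : ∀ᶠ q in 𝓝 p, ContMDiffAt 𝓘(ℝ, E) 𝓘(ℝ, ℝ) ∞ (η i) q :=
    hsource.mono fun q hq ↦ (hη i).contMDiffAt (φ.open_source.mem_nhds hq)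
  have hdet (q) (hq : q ∈ φ.source) :=
    PoissonLinear.isCosymplectic_iff_det_ne_zero (s := B.sharp q) (hframe q hq).1 (hframe q hq).2
  have hcont : ContinuousAt (fun q ↦ (Matrix.of fun i j ↦ mvfderiv 𝓘(ℝ, E) (η i) q
      (B.sharp q (mvfderiv 𝓘(ℝ, E) (η j) q).toLinearMap)).det) p :=
    continuous_id.matrix_det.continuousAt.comp <| continuousAt_pi.2 fun i ↦
      continuousAt_pi.2 fun j ↦ (B.eventually_contMDiffAt_mvfderiv_sharp_mvfderiv (hη_near j)
        (hη_near i)).self_of_nhds.continuousAt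
  filter_upwards [hsource, hcont.eventually_ne ((hdet p hp).1 h)] with q hq hne
  exact (hdet q hq).2 hne

theorem exists_map_sharpAnn_eq_span {S : Set P} {p : P} {φ : OpenPartialHomeomorph P E}
    {F : Submodule ℝ E} (hφ : IsSliceChart S p φ F) {g : P → X}
    (hg : ∀ᶠ q in 𝓝 p, ContMDiffAt 𝓘(ℝ, E) 𝓘(ℝ, X) ∞ g q) :
    ∃ (n : ℕ) (u : Fin n → P → X),
      (∀ i, ∀ᶠ q in 𝓝 p, ContMDiffAt 𝓘(ℝ, E) 𝓘(ℝ, X) ∞ (u i) q) ∧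
      ∀ᶠ q in 𝓝[S] p, (PoissonLinear.sharpAnn (B.sharp q) (submanifoldTangent E S q)).map
        (mvfderiv 𝓘(ℝ, E) g q).toLinearMap = Submodule.span ℝ (Set.range fun i ↦ u i q) := by
  obtain ⟨n, η, hη, hframe⟩ := exists_forall_linearIndependent_mvfderiv hφ.mem_maximalAtlas F
  have hsource := φ.open_source.eventually_mem hφ.mem_source
  refine ⟨n, fun i q ↦ mvfderiv 𝓘(ℝ, E) g q
    (B.sharp q (mvfderiv 𝓘(ℝ, E) (η i) q).toLinearMap), fun i ↦
    B.eventually_contMDiffAt_mvfderiv_sharp_mvfderiv (hsource.mono fun q hq ↦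
      (hη i).contMDiffAt (φ.open_source.mem_nhds hq)) hg, ?_⟩
  refine eventually_nhdsWithin_iff.2 (hsource.mono fun q hq hqS ↦ ?_)
  rw [submanifoldTangent_eq hqS (hφ.of_mem_source hq), PoissonLinear.sharpAnn]
  refine (congrArg (fun W ↦ (W.map (B.sharp q)).map (mvfderiv 𝓘(ℝ, E) g q).toLinearMap)
    (hframe q hq).2).trans ?_
  rw [Submodule.map_span, Submodule.map_span, ← Set.range_comp, ← Set.range_comp]
  rfl

end BivectorField

end SmoothSharp

/-! ### The cosymplectic submanifold -/

section CosymplecticSubmanifold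

variable {E : Type*} [NormedAddCommGroup E] [NormedSpace ℝ E]
  {P : Type*} [TopologicalSpace P] [ChartedSpace E P]

theorem IsSliceChart.inter_of_isOpen {S O : Set P} {p : P} {φ : OpenPartialHomeomorph P E}
    {F : Submodule ℝ E} (hφ : IsSliceChart S p φ F) (hO : IsOpen O) (hp : p ∈ O) :
    IsSliceChart (S ∩ O) p (φ.restr O) F := by
  refine ⟨restr_mem_maximalAtlas _ hφ.mem_maximalAtlas hO, ?_, fun q hq ↦ ?_⟩
  · exact (φ.restr_source' O hO).superset ⟨hφ.mem_source, hp⟩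
  · rw [φ.restr_source' O hO] at hq
    exact (and_iff_left hq.2).trans (hφ.mem_iff q hq.1)

variable [FiniteDimensional ℝ E] [IsManifold 𝓘(ℝ, E) ∞ P]

theorem submanifoldTangent_inter_of_isOpen {S O : Set P} {p : P} {φ : OpenPartialHomeomorph P E}
    {F : Submodule ℝ E} (hφ : IsSliceChart S p φ F) (hS : p ∈ S) (hO : IsOpen O) (hp : p ∈ O) :
    submanifoldTangent E (S ∩ O) p = submanifoldTangent E S p :=
  (submanifoldTangent_eq (S := S ∩ O) ⟨hS, hp⟩ (hφ.inter_of_isOpen hO hp)).trans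
    (submanifoldTangent_eq hS hφ).symm

theorem IsSliceChart.finrank_submanifoldTangent {S : Set P} {p : P}
    {φ : OpenPartialHomeomorph P E} {F : Submodule ℝ E} (hφ : IsSliceChart S p φ F) (hp : p ∈ S) :
    Module.finrank ℝ (submanifoldTangent E S p) = Module.finrank ℝ F := by
  let A := LinearEquiv.ofBijective (mvfderiv 𝓘(ℝ, E) φ p).toLinearMap
    (mvfderiv_chart_bijective hφ.mem_maximalAtlas hφ.mem_source)
  rw [submanifoldTangent_eq hp hφ]
  exact (congrArg (fun W : Submodule ℝ _ ↦ Module.finrank ℝ W)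
    (Submodule.comap_equiv_eq_map_symm A F)).trans (A.symm.finrank_map_eq F)

theorem BivectorField.exists_isOpen_isCosymplectic_inter (B : BivectorField E P) {S C : Set P}
    {m : ℕ} (hCS : C ⊆ S)
    (hS : ∀ p ∈ C, ∃ (φ : OpenPartialHomeomorph P E) (F : Submodule ℝ E),
      IsSliceChart S p φ F ∧ Module.finrank ℝ F = m)
    (hC : ∀ p ∈ C, PoissonLinear.IsCosymplectic (B.sharp p) (submanifoldTangent E S p)) :
    ∃ O : Set P, IsOpen O ∧ C ⊆ O ∧ IsEmbeddedSubmanifold E (S ∩ O) m ∧ ∀ p ∈ S ∩ O,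
      PoissonLinear.IsCosymplectic (B.sharp p) (submanifoldTangent E (S ∩ O) p) := by
  let O : Set P := {p | ∃ (φ : OpenPartialHomeomorph P E) (F : Submodule ℝ E),
    IsSliceChart S p φ F ∧ Module.finrank ℝ F = m ∧
      PoissonLinear.IsCosymplectic (B.sharp p) (F.comap (mvfderiv 𝓘(ℝ, E) φ p).toLinearMap)}
  have hO : IsOpen O := isOpen_iff_mem_nhds.2 fun p ⟨φ, F, hφ, hF, hp⟩ ↦ by
    filter_upwards [φ.open_source.mem_nhds hφ.mem_source,
      B.eventually_isCosymplectic_comap_mvfderiv hφ.mem_maximalAtlas hφ.mem_source hp]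
      with q hq hcos using ⟨φ, F, hφ.of_mem_source hq, hF, hcos⟩
  refine ⟨O, hO, fun p hp ↦ ?_, fun p ⟨_, hpO⟩ ↦ ?_, fun p ⟨hpS, hpO⟩ ↦ ?_⟩
  · obtain ⟨φ, F, hφ, hF⟩ := hS p hp
    exact ⟨φ, F, hφ, hF, submanifoldTangent_eq (hCS hp) hφ ▸ hC p hp⟩
  · have ⟨φ, F, hφ, hF, _⟩ := hpO
    exact ⟨_, F, hφ.inter_of_isOpen hO hpO, hF⟩
  · have ⟨φ, F, hφ, _, hcos⟩ := hpO
    rwa [submanifoldTangent_inter_of_isOpen hφ hpS hO hpO, submanifoldTangent_eq hpS hφ]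

end CosymplecticSubmanifold

section Assembly

variable {E : Type*} [NormedAddCommGroup E] [NormedSpace ℝ E]
  {P : Type*} [TopologicalSpace P] [ChartedSpace E P]

theorem exists_eventually_isIdempotentElem {A : Type*} [NormedRing A] [NormedAlgebra ℝ A]
    [CompleteSpace A] {N : P → A} {C : Set P}
    (hN : ∀ p ∈ C, ∀ᶠ q in 𝓝 p, ContMDiffAt 𝓘(ℝ, E) 𝓘(ℝ, A) ∞ N q)
    (hid : ∀ p ∈ C, IsIdempotentElem (N p)) :
    ∃ Ψ : P → A, ∀ p ∈ C, Ψ p = N p ∧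
      ∀ᶠ q in 𝓝 p, ContMDiffAt 𝓘(ℝ, E) 𝓘(ℝ, A) ∞ Ψ q ∧ IsIdempotentElem (Ψ q) := by
  obtain ⟨σ, hσ⟩ := exists_idempotent_correction A
  refine ⟨σ ∘ N, fun p hp ↦ ⟨(hσ _ (hid p hp)).1, ?_⟩⟩
  have hcont : ContinuousAt N p := (hN p hp).self_of_nhds.continuousAt
  filter_upwards [hN p hp, hcont.eventually (hσ _ (hid p hp)).2] with q hNq hσq
  exact ⟨hσq.2.contMDiffAt.comp q hNq, hσq.1⟩

theorem convex_setOf_isProj {X : Type*} [NormedAddCommGroup X] [NormedSpace ℝ X]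
    (K : Submodule ℝ X) : Convex ℝ {N : X →L[ℝ] X | LinearMap.IsProj K N} := by
  refine fun N hN N' hN' a b _ _ hab ↦ ⟨fun x ↦ ?_, fun x hx ↦ ?_⟩
  · exact K.add_mem (K.smul_mem a (hN.map_mem x)) (K.smul_mem b (hN'.map_mem x))
  · change a • N x + b • N' x = x
    rw [hN.map_id x hx, hN'.map_id x hx, ← add_smul, hab, one_smul]

variable [FiniteDimensional ℝ E] [IsManifold 𝓘(ℝ, E) ∞ P]
  {X : Type*} [NormedAddCommGroup X] [NormedSpace ℝ X]

theorem IsDefiningMapOn.finrank_map_sharpAnn {B : BivectorField E P} {C O : Set P} {k r : ℕ}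
    {f : P → X} (hf : IsDefiningMapOn E f C O) (hC : IsEmbeddedSubmanifold E C k) {p : P}
    (hpO : p ∈ O) (hp : p ∈ C)
    (hr : Module.finrank ℝ ↥(submanifoldTangent E C p ⊔
      PoissonLinear.sharpAnn (B.sharp p) (submanifoldTangent E C p)) = r) :
    Module.finrank ℝ ((PoissonLinear.sharpAnn (B.sharp p) (submanifoldTangent E C p)).map
      (mvfderiv 𝓘(ℝ, E) f p).toLinearMap) = r - k := by
  obtain ⟨φ, F, hφ, rfl⟩ := hC p hp
  have h := finrank_map_add_finrank_ker (mvfderiv 𝓘(ℝ, E) f p).toLinearMap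
    (PoissonLinear.sharpAnn (B.sharp p) (submanifoldTangent E C p))
  rw [hf.ker_mvfderiv p hpO hp, hr, hφ.finrank_submanifoldTangent hp] at h
  exact Nat.eq_sub_of_add_eq h

theorem IsDefiningMapOn.exists_idempotent_isProj [CompleteSpace X] [T2Space P]
    [SecondCountableTopology P] {B : BivectorField E P} {C O : Set P} {k r : ℕ} {f : P → X}
    (hf : IsDefiningMapOn E f C O) (hCO : C ⊆ O) (hC : IsEmbeddedSubmanifold E C k)
    (hr : ∀ p ∈ C, Module.finrank ℝ ↥(submanifoldTangent E C p ⊔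
      PoissonLinear.sharpAnn (B.sharp p) (submanifoldTangent E C p)) = r) :
    ∃ Ψ : P → X →L[ℝ] X, ∀ p ∈ C,
      LinearMap.IsProj ((PoissonLinear.sharpAnn (B.sharp p) (submanifoldTangent E C p)).map
        (mvfderiv 𝓘(ℝ, E) f p).toLinearMap) (Ψ p).toLinearMap ∧
      ∀ᶠ q in 𝓝 p, ContMDiffAt 𝓘(ℝ, E) 𝓘(ℝ, X →L[ℝ] X) ∞ Ψ q ∧ IsIdempotentElem (Ψ q) := by
  let K (p : P) : Submodule ℝ X :=
    (PoissonLinear.sharpAnn (B.sharp p) (submanifoldTangent E C p)).map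
      (mvfderiv 𝓘(ℝ, E) f p).toLinearMap
  have hconvex (p : P) : Convex ℝ {N : X →L[ℝ] X | p ∈ C → LinearMap.IsProj (K p) N} := by
    by_cases hp : p ∈ C
    · simpa only [hp, forall_const] using convex_setOf_isProj (K p)
    · simpa only [hp, false_imp_iff, Set.ofPred_true] using convex_univ
  obtain ⟨N, U, hU, hCU, hN, hproj⟩ := exists_contMDiffOn_forall_mem_convex hconvex fun p hp ↦ by
    obtain ⟨φ, F, hφ, -⟩ := hC p hp
    obtain ⟨n, u, hu, hspan⟩ :=
      B.exists_map_sharpAnn_eq_span hφ (hf.eventually_contMDiffAt (hCO hp))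
    exact exists_contMDiffAt_isProj_of_finrank_eq hp hu hspan fun q hq ↦
      hf.finrank_map_sharpAnn hC (hCO hq) hq (hr q hq)
  have hN_near (p) (hp : p ∈ C) : ∀ᶠ q in 𝓝 p, ContMDiffAt 𝓘(ℝ, E) 𝓘(ℝ, X →L[ℝ] X) ∞ N q :=
    (hU.eventually_mem (hCU hp)).mono fun q hq ↦ hN.contMDiffAt (hU.mem_nhds hq)
  have hN_proj (p) (hp : p ∈ C) : LinearMap.IsProj (K p) (N p).toLinearMap :=
    ⟨(hproj p (hCU hp) hp).map_mem, (hproj p (hCU hp) hp).map_id⟩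
  obtain ⟨Ψ, hΨ⟩ := exists_eventually_isIdempotentElem hN_near fun p hp ↦
    ContinuousLinearMap.coe_injective
      ((LinearMap.isProj_iff_isIdempotentElem _).1 ⟨K p, hN_proj p hp⟩)
  exact ⟨Ψ, fun p hp ↦ ⟨(hΨ p hp).1.symm ▸ hN_proj p hp, (hΨ p hp).2⟩⟩

theorem IsDefiningMapOn.exists_isSliceChart_setOf_eq_zero {B : BivectorField E P} {C O : Set P}
    {f : P → X} {Ψ : P → X →L[ℝ] X} {p : P} {d : ℕ} (hf : IsDefiningMapOn E f C O) (hpO : p ∈ O)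
    (hp : p ∈ C)
    (hd : Module.finrank ℝ ((PoissonLinear.sharpAnn (B.sharp p) (submanifoldTangent E C p)).map
      (mvfderiv 𝓘(ℝ, E) f p).toLinearMap) = d)
    (hproj : LinearMap.IsProj ((PoissonLinear.sharpAnn (B.sharp p)
      (submanifoldTangent E C p)).map (mvfderiv 𝓘(ℝ, E) f p).toLinearMap) (Ψ p).toLinearMap)
    (hΨ : ∀ᶠ q in 𝓝 p, ContMDiffAt 𝓘(ℝ, E) 𝓘(ℝ, X →L[ℝ] X) ∞ Ψ q ∧ IsIdempotentElem (Ψ q)) :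
    ∃ (φ : OpenPartialHomeomorph P E) (F : Submodule ℝ E),
      IsSliceChart {q | Ψ q (f q) = 0} p φ F ∧ Module.finrank ℝ F = Module.finrank ℝ E - d ∧
      PoissonLinear.IsCosymplecticExtension (B.sharp p) (submanifoldTangent E C p)
        (submanifoldTangent E {q | Ψ q (f q) = 0} p) := by
  have hfp : f p = 0 := hf.apply_eq_zero p hpO hp
  have hrange : (Ψ p).range ≤ (Ψ p ∘L mvfderiv 𝓘(ℝ, E) f p).range := by
    rw [hproj.range]
    rintro _ ⟨v, hv, rfl⟩
    exact ⟨v, hproj.map_id _ ⟨v, hv, rfl⟩⟩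
  obtain ⟨φ, F, hφ, hF, hker⟩ := exists_isSliceChart_setOf_idempotent_apply_eq_zero
    (hf.eventually_contMDiffAt hpO) hfp hΨ hrange
  rw [hproj.range, hd] at hF
  refine ⟨φ, F, hφ, Nat.eq_sub_of_add_eq hF, ?_⟩
  have hpS : p ∈ {q | Ψ q (f q) = 0} := by rw [Set.mem_ofPred_eq, hfp, map_zero]
  rw [submanifoldTangent_eq hpS hφ]
  rw [← hf.ker_mvfderiv p hpO hp] at hproj ⊢
  exact hker ▸ PoissonLinear.isCosymplecticExtension_ker_comp hproj

end Assembly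

theorem mainTheorem1_general {E : Type*} [NormedAddCommGroup E] [NormedSpace ℝ E]
    [FiniteDimensional ℝ E] {P : Type*} [TopologicalSpace P] [T2Space P]
    [SecondCountableTopology P] [ChartedSpace E P] [IsManifold 𝓘(ℝ, E) ∞ P]
    (B : BivectorField E P) (C : Set P) (k : ℕ) (hC : IsEmbeddedSubmanifold E C k)
    (hpre : ∃ r : ℕ, ∀ p ∈ C, Module.finrank ℝ ↥(submanifoldTangent E C p ⊔
      PoissonLinear.sharpAnn (B.sharp p) (submanifoldTangent E C p)) = r) :
    ∃ (S : Set P) (m : ℕ) (_ : IsEmbeddedSubmanifold E S m) (hCS : C ⊆ S)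
      (hS : ∀ p ∈ S, PoissonLinear.IsCosymplectic (B.sharp p) (submanifoldTangent E S p)),
      ∀ (p : P) (hp : p ∈ C), PoissonLinear.IsCoisotropic
        (PoissonLinear.inducedSharp (B.isSkew_sharp p) (hS p (hCS hp)))
        ((submanifoldTangent E C p).comap (submanifoldTangent E S p).subtype) := by
  obtain ⟨r, hr⟩ := hpre
  obtain ⟨f, O, hCO, hf⟩ := hC.exists_isDefiningMapOn
  obtain ⟨Ψ, hΨ⟩ := hf.exists_idempotent_isProj hCO hC hr
  let S : Set P := {q | Ψ q (f q) = 0}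
  have hCS : C ⊆ S := fun p hp ↦ by
    rw [Set.mem_ofPred_eq, hf.apply_eq_zero p (hCO hp) hp, map_zero]
  choose φ F hφ hF hext using fun p (hp : p ∈ C) ↦ hf.exists_isSliceChart_setOf_eq_zero (hCO hp) hp
    (hf.finrank_map_sharpAnn hC (hCO hp) hp (hr p hp)) (hΨ p hp).1 (hΨ p hp).2
  obtain ⟨U, hU, hCU, hSU, hcos⟩ := B.exists_isOpen_isCosymplectic_inter hCS
    (fun p hp ↦ ⟨φ p hp, F p hp, hφ p hp, hF p hp⟩)
    fun p hp ↦ (hext p hp).isCosymplectic (B.isSkew_sharp p)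
  refine ⟨S ∩ U, _, hSU, Set.subset_inter hCS hCU, hcos, fun p hp ↦ ?_⟩
  have hT := submanifoldTangent_inter_of_isOpen (hφ p hp) (hCS hp) hU (hCU hp)
  exact (hT.symm ▸ hext p hp).isCoisotropic (B.isSkew_sharp p) _

theorem mainTheorem1 {E : Type*} [NormedAddCommGroup E] [NormedSpace ℝ E] [FiniteDimensional ℝ E]
    {P : Type*} [TopologicalSpace P] [T2Space P] [SecondCountableTopology P]
    [ChartedSpace E P] [IsManifold 𝓘(ℝ, E) ∞ P]
    (B : PoissonStructure E P) (C : Set P) (k : ℕ)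
    (hC : IsEmbeddedSubmanifold E C k) (hpre : B.IsPrePoisson C) :
    ∃ (S : Set P) (m : ℕ) (_ : IsEmbeddedSubmanifold E S m) (hCS : C ⊆ S)
      (hS : B.IsCosymplectic S), B.IsCoisotropicIn hCS hS :=
  mainTheorem1_general B.toBivectorField C k hC hpre
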